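/- Let $X$ be a smooth $4$-manifold without boundary, $\Sigma\subset X$ a smoothly embedded surface (a closed subset), and $\alpha$ a smooth simple closed curve in $\Sigma$ with a trivialized tubular neighbourhood $\alpha\times I\times D^2=\alpha\times B^3\subset X$, where $\alpha\times I\times\{0\}$ is its intersection with $\Sigma$; write $(B^3,I)$ for the trivial ball pair and identify $\alpha$ with $S^1$. Let $K\subset S^3$ be a smooth knot with a $0$-framed tubular neighbourhood $K\times D^2$, exterior $E(K)$, meridian $\mu_K$ and longitude $\lambda_K$, and let $(B^3,K_+)$ be the ball pair obtained from $(S^3,K)$ by removing a small trivial ball pair around a point of $K$, inside $K\times D^2$. Let $\tau$ be the twist map of $(S^3,K)$: in a collar $K\times\partial D^2\times[0,1]$ of $\partial E(K)=K\times\partial D^2\times\{0\}$ in $E(K)$ it is $\tau(x,e^{i\theta},t)=(x,e^{i(\theta+2\pi\rho(t))},t)$, where $\rho$ is a smooth non-decreasing step function, equal to $0$ for $t\le 0$ and to $1$ for $t\ge 1$, and $\tau$ is the identity outside the collar. Let $m$ be an integer. (1) Let $$(X,\Sigma_K(m))_1=\bigl((X,\Sigma)-S^1\times(B^3,I)\bigr)\cup_\partial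 S^1\times_{\tau^m}(B^3,K_+),$$ where $S^1\times_{\tau^m}(B^3,K_+)$ is $(B^3,K_+)\times[0,1]$ with $(x,0)$ identified with $(\tau^m x,1)$, and the boundaries $\partial(B^3,I)$ and $\partial(B^3,K_+)$ are identified in the standard way, the oriented arc $I$ corresponding to $K_+$ and the meridian of $I$ to that of $K_+$. (2) Let $\gamma\subset B^3$ be a meridian circle of the arc $I$, pushed into the interior of $B^3$, with tubular neighbourhood $N(\gamma)=\gamma\times D^2\subset B^3-I$ and push-off $\gamma'\subset\partial N(\gamma)$ (the parallel circle which is null-homologous in $B^3-N(\gamma)$ if one forgets $I$); orient $\gamma$ as the meridian of $I$, and the meridian $\partial D^2$ of $\gamma$ so that it runs parallel to the oriented arc $I$ on the side of $\gamma$ facing $I$; let $T=\alpha\times\gamma$ be the rim torus, with neighbourhood $N(T)=\alpha\times N(\gamma)$. Let $$(X,\Sigma_K(m))_2=(X-N(T),\Sigma)\cup_\varphi(E(K)\times S^1,\emptyset),$$ where $\varphi\colon\partial N(T)\to\partial E(K)\times S^1$ is the linear diffeomorphism of $3$-tori with $\varphi_*(\alpha)=m\mu_K+S^1$, $\varphi_*(\gamma')=\mu_K$,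 $\varphi_*(\partial D^2)=\lambda_K$. Then both constructions yield a smooth $4$-manifold with a smoothly embedded surface, and the two resulting pairs are pairwise diffeomorphic: there is a diffeomorphism between the two ambient $4$-manifolds which maps the one surface onto the other. -/

import Mathlib

open scoped Manifold ContDiff

universe u

noncomputable section

namespace TwistRim

/-! ## Smooth 4-manifolds with an embedded surface -/

/-- `S` is a smoothly embedded surface in the 4-manifold `X`: a closed subset with slice charts,
in which `S` is the plane where the last two coordinates vanish. -/
def IsEmbeddedSurface {X : Type u} [TopologicalSpace X]
    [ChartedSpace (EuclideanSpace ℝ (Fin 4)) X] (S : Set X) : Prop :=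
  IsClosed S ∧ ∀ x ∈ S, ∃ e ∈ IsManifold.maximalAtlas (𝓡 4) ∞ X,
    x ∈ e.source ∧ ∀ y ∈ e.source, y ∈ S ↔ (e y) 2 = 0 ∧ (e y) 3 = 0

/-- A pair `(X, Σ)`: a smooth 4-manifold (Hausdorff, second countable, without boundary) together
with a smoothly embedded surface. -/
structure SurfacePair where
  carrier : Type u
  [top : TopologicalSpace carrier]
  [charted : ChartedSpace (EuclideanSpace ℝ (Fin 4)) carrier]
  [manifold : IsManifold (𝓡 4) ∞ carrier]
  [t2 : T2Space carrier]
  [secondCountable : SecondCountableTopology carrier]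
  surface : Set carrier
  embedded : IsEmbeddedSurface surface

attribute [instance] SurfacePair.top SurfacePair.charted SurfacePair.manifold SurfacePair.t2
  SurfacePair.secondCountable

/-- Pairwise diffeomorphism `(X, Σ) ≅ (X', Σ')`. -/
def PairwiseDiffeomorphic (P Q : SurfacePair.{u}) : Prop :=
  ∃ f : P.carrier ≃ₘ^∞⟮𝓡 4, 𝓡 4⟯ Q.carrier, f '' P.surface = Q.surface

/-! ## The neighbourhood of the curve `α` -/

/-- A trivialized tubular neighbourhood `α × ℝ × ℂ = α × (open 3-ball)` of a simple closed curve
`α` in the surface of `P`: an open smooth embedding `σ` into the 4-manifold, in which the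
`ℝ`-factor is normal to `α` in the surface, and the `ℂ`-factor is normal to the surface. -/
structure CurveTrivialization (P : SurfacePair.{u}) (α : Circle → P.carrier) where
  toFun : Circle × ℝ × ℂ → P.carrier
  localDiffeo : IsLocalDiffeomorph ((𝓡 1).prod (𝓘(ℝ, ℝ).prod 𝓘(ℝ, ℂ))) (𝓡 4) ∞ toFun
  injective : Function.Injective toFun
  zero_section : ∀ θ, toFun (θ, 0, 0) = α θ
  mem_surface_iff : ∀ θ t z, toFun (θ, t, z) ∈ P.surface ↔ z = 0

/-- The closed ball `B³` of radius 2 in `ℝ × ℂ`. Its intersection with the axis `ℝ × {0}` is the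
trivial arc `I`. -/
def ball : Set (ℝ × ℂ) := {p | p.1 ^ 2 + ‖p.2‖ ^ 2 ≤ 4}

/-! ## Knots in the 3-sphere -/

/-- The 3-sphere. -/
abbrev S3 : Type := Metric.sphere (0 : EuclideanSpace ℝ (Fin 4)) 1

/-- A parametrized open tubular neighbourhood `ν : S¹ × ℂ → S³` of the knot `K`. In particular
`K = ν (S¹ × {0})` is a smooth knot, oriented by `ν`. The compact tubular neighbourhood
`K × D²` is `ν (S¹ × {‖ζ‖ ≤ 2})`, so the exterior `E(K)` is the complement of
`ν (S¹ × {‖ζ‖ < 2})`; the meridian `μ_K` is a circle `ν ({c} × {‖ζ‖ = r})`. -/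
structure KnotTube (K : Set S3) where
  toFun : Circle × ℂ → S3
  localDiffeo : IsLocalDiffeomorph ((𝓡 1).prod 𝓘(ℝ, ℂ)) (𝓡 3) ∞ toFun
  injective : Function.Injective toFun
  core : Set.range (fun c : Circle => toFun (c, 0)) = K

namespace KnotTube

variable {K : Set S3} (ν : KnotTube K)

theorem mem_compl (c : Circle) {ζ : ℂ} (hζ : ζ ≠ 0) : ν.toFun (c, ζ) ∈ Kᶜ := by
  intro hK
  obtain ⟨c', h⟩ : ν.toFun (c, ζ) ∈ Set.range (fun c : Circle => ν.toFun (c, 0)) := by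
    rwa [ν.core]
  exact hζ (congrArg Prod.snd (ν.injective h)).symm

/-- The longitude `ν (S¹ × {1})`, as a loop in the knot complement. -/
def longitude : Path (⟨ν.toFun (1, 1), ν.mem_compl 1 one_ne_zero⟩ : (Kᶜ : Set S3))
    ⟨ν.toFun (1, 1), ν.mem_compl 1 one_ne_zero⟩ where
  toFun t := ⟨ν.toFun (Circle.exp (2 * Real.pi * t), 1), ν.mem_compl _ one_ne_zero⟩
  continuous_toFun := by
    refine Continuous.subtype_mk (ν.localDiffeo.contMDiff.continuous.comp ?_) _
    fun_prop
  source' := by simp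
  target' := by simp

/-- The tube has the 0-framing: its longitude is null-homologous in the knot complement, that is,
its class is zero in the abelianized fundamental group. -/
def IsZeroFramed : Prop :=
  FundamentalGroup.fromPath (Path.Homotopic.Quotient.mk ν.longitude) ∈
    commutator (FundamentalGroup (Kᶜ : Set S3) ⟨ν.toFun (1, 1), ν.mem_compl 1 one_ne_zero⟩)

/-- The angle function of the twist: `0` for `‖ζ‖ ≤ 2`, and `2π` for `‖ζ‖ ≥ 3`; in between it is
`2π t` at `‖ζ‖ = 2 + t`, up to a smooth reparametrization of `[0, 1]`. -/
def angle (ζ : ℂ) : ℝ := 2 * Real.pi * Real.smoothTransition (‖ζ‖ - 2)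

open Classical in
/-- Rotation of each normal disc of the tube by `ε` times the angle function; the identity
outside the tube. -/
def rotate (ε : ℝ) (q : S3) : S3 :=
  if h : ∃ p : Circle × ℂ, ν.toFun p = q then
    ν.toFun (h.choose.1, Circle.exp (ε * angle h.choose.2) * h.choose.2)
  else q

theorem rotate_tube (ε : ℝ) (c : Circle) (ζ : ℂ) :
    ν.rotate ε (ν.toFun (c, ζ)) = ν.toFun (c, Circle.exp (ε * angle ζ) * ζ) := by
  have h : ∃ p : Circle × ℂ, ν.toFun p = ν.toFun (c, ζ) := ⟨_, rfl⟩
  have h2 : h.choose = (c, ζ) := ν.injective h.choose_spec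
  rw [rotate, dif_pos h, h2]

theorem rotate_rotate_neg {ε δ : ℝ} (hεδ : ε + δ = 0) (q : S3) :
    ν.rotate ε (ν.rotate δ q) = q := by
  by_cases h : ∃ p : Circle × ℂ, ν.toFun p = q
  · obtain ⟨⟨c, ζ⟩, rfl⟩ := h
    have h1 : angle (Circle.exp (δ * angle ζ) * ζ) = angle ζ := by
      rw [angle, norm_mul, Circle.norm_coe, one_mul, angle]
    have h2 : ε * angle ζ + δ * angle ζ = 0 := by rw [← add_mul, hεδ, zero_mul]
    rw [rotate_tube, rotate_tube, h1, ← mul_assoc, ← Circle.coe_mul, ← Circle.exp_add, h2]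
    simp
  · have h1 : ν.rotate δ q = q := by rw [rotate, dif_neg h]
    rw [h1, rotate, dif_neg h]

/-- The twist map `τ` of `(S³, K)`: it sends `(c, e^{iθ}, t)` to `(c, e^{i(θ + 2πt)}, t)` in the
collar `2 ≤ ‖ζ‖ ≤ 3` of `∂E(K)` in `E(K)` (with `t` reparametrized so that `τ` is smooth), and is
the identity outside the collar. -/
def twist : Equiv.Perm S3 where
  toFun := ν.rotate 1
  invFun := ν.rotate (-1)
  left_inv := ν.rotate_rotate_neg (by norm_num)
  right_inv := ν.rotate_rotate_neg (by norm_num)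

/-- The point of the knot around which a trivial ball pair is removed from `(S³, K)`. -/
def point : S3 := ν.toFun (1, 0)

end KnotTube

/-! ## The complement of the unknot `γ` -/

/-- With `p = (t, z)`, the complex number `|p|² - 1 - 2it`. It vanishes exactly on the meridian
circle `γ = {t = 0, |z| = 1}` of the arc `I`, and `p ↦ arg` winds once around a meridian of `γ`. -/
def winding (p : ℝ × ℂ) : ℂ := ⟨p.1 ^ 2 + ‖p.2‖ ^ 2 - 1, -2 * p.1⟩

/-- The standard diffeomorphism from the complement of the unknot `γ` in `(ℝ × ℂ) ∪ {∞} = S³`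
onto the open solid torus `S¹ × ℂ`, with the point `∞` being sent to `(1, 0)`. It is equivariant
for the rotations of `ℂ`, and in the half-plane `t + ir` with `r = |z|` it is the
Cayley transformation followed by a radial rescaling. The upward oriented axis `ℝ × {0}` goes to
`S¹ × {0}` minus `(1, 0)` in the counterclockwise direction; circles around the axis go to
meridians of the solid torus; the meridians of `γ` (going up on the side of the axis) go
to longitudes `S¹ × {pt}`. -/
def toSolidTorus (p : ℝ × ℂ) : Circle × ℂ :=
  (Circle.exp (winding p).arg, ((2 / ‖winding p‖ : ℝ) : ℂ) * p.2)

/-- The closed tubular neighbourhood `N(γ)` of `γ`: its complement is the part `‖ζ‖ < 2` of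
the solid torus, and it is the solid torus in `ℝ × ℂ` obtained by rotating around the axis the
disc of radius `1/2` about `(t, r) = (0, √5/2)`. It lies in the interior of the ball, and is
disjoint from the axis. -/
def nbhdγ : Set (ℝ × ℂ) := {p | ‖winding p‖ ≤ ‖p.2‖}

/-! ## Gluing -/

/-- `Q` is obtained by gluing the open piece `U` of the manifold `A` with a smooth quotient of
the open piece `V` of the manifold `B`.
* `r` is the equivalence relation by which `V` is divided (equality if there is no quotient);
* `g a b` says that the point `a` of `U` is glued to the point `b` of `V`;
* the surface of `Q` is the union of the images of `SA ∩ U` and `SB ∩ V`.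
The maps `i` and `j` are smooth local diffeomorphisms which together cover `Q` and make precisely
the prescribed identifications. This determines `Q` up to pairwise diffeomorphism. -/
def IsGluing {EA HA EB HB : Type} [NormedAddCommGroup EA] [NormedSpace ℝ EA] [TopologicalSpace HA]
    [NormedAddCommGroup EB] [NormedSpace ℝ EB] [TopologicalSpace HB]
    (IA : ModelWithCorners ℝ EA HA) (IB : ModelWithCorners ℝ EB HB)
    {A : Type u} [TopologicalSpace A] [ChartedSpace HA A]
    {B : Type} [TopologicalSpace B] [ChartedSpace HB B]
    (U : Set A) (V : Set B) (r : B → B → Prop) (g : A → B → Prop) (SA : Set A) (SB : Set B)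
    (Q : SurfacePair.{u}) : Prop :=
  ∃ (i : A → Q.carrier) (j : B → Q.carrier),
    IsLocalDiffeomorphOn IA (𝓡 4) ∞ i U ∧
    IsLocalDiffeomorphOn IB (𝓡 4) ∞ j V ∧
    Set.InjOn i U ∧
    (∀ b ∈ V, ∀ b' ∈ V, j b = j b' ↔ r b b') ∧
    (∀ a ∈ U, ∀ b ∈ V, i a = j b ↔ g a b) ∧
    i '' U ∪ j '' V = Set.univ ∧
    Q.surface = i '' (SA ∩ U) ∪ j '' (SB ∩ V)

/-! ## The two descriptions of `m`-twist rim surgery -/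

variable {P : SurfacePair.{u}} {α : Circle → P.carrier} {K : Set S3}

/-- First description: `(X, Σ) - S¹ × (B³, I) ∪ S¹ ×_{τ^m} (B³, K₊)`.

The ball pair `(B³, K₊)` is `(S³, K)` minus a small trivial ball pair around a point of `K`; as an
open ball pair it is `(S³ ∖ {pt}, K ∖ {pt})`. The mapping torus `S¹ ×_{τ^m} (B³, K₊)` is the
quotient of `(B³, K₊) × ℝ` by `(q, s) ∼ (τ^m q, s + 1)`. The complement of `σ (S¹ × B³)` is glued
to it along the open collar `σ (S¹ × {|p| > 2})` of the boundary of `σ (S¹ × B³)`: the end of the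
open ball pair `(ℝ × ℂ, ℝ × {0})` is identified with the end of `(S³ ∖ {pt}, K ∖ {pt})` by
`p ↦ ν (toSolidTorus p)`, which matches the endpoints of the arc `I` with those of `K₊` and the
meridians of `I` with those of `K₊`; on this end `τ` is the identity. -/
def IsTwistRimSurgery (σ : CurveTrivialization P α) (ν : KnotTube K) (m : ℤ)
    (Q : SurfacePair.{u}) : Prop :=
  IsGluing (𝓡 4) ((𝓡 3).prod 𝓘(ℝ, ℝ)) (A := P.carrier) (B := S3 × ℝ)
    (σ.toFun '' (Set.univ ×ˢ ball))ᶜ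
    {b | b.1 ≠ ν.point}
    (fun b b' => ∃ k : ℤ, b'.1 = ((ν.twist ^ m) ^ k) b.1 ∧ b'.2 = b.2 + k)
    (fun x b => ∃ p : ℝ × ℂ, p ∉ ball ∧ x = σ.toFun (Circle.exp (2 * Real.pi * b.2), p) ∧
      b.1 = ν.toFun (toSolidTorus p))
    P.surface
    {b | b.1 ∈ K}
    Q

/-- Second description: `(X - N(T), Σ) ∪_φ (E(K) × S¹, ∅)`, where `T = σ (S¹ × γ)` is the rim
torus, and `N(T) = σ (S¹ × N(γ))`.

Here `E(K)` is enlarged by the open collar `ν (S¹ × {0 < ‖ζ‖ < 2})` to `S³ ∖ K`, which is glued to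
the corresponding open collar of the boundary of `X - N(T)`. In the coordinates `θ` on `α`, `c` on
the meridian `∂D²` of the rim torus, and `ζ / |ζ|` on `γ'`, the gluing map `φ` of the boundary
3-tori is the linear map `(θ, c, ζ) ↦ (ν (c, θ^m ζ), θ)`. So `φ(α) = m μ_K + S¹`, `φ(γ') = μ_K`, and
`φ(∂D²) = λ_K`. -/
def IsRimTorusSurgery (σ : CurveTrivialization P α) (ν : KnotTube K) (m : ℤ)
    (Q : SurfacePair.{u}) : Prop :=
  IsGluing (𝓡 4) ((𝓡 3).prod (𝓡 1)) (A := P.carrier) (B := S3 × Circle)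
    (σ.toFun '' (Set.univ ×ˢ nbhdγ))ᶜ
    {b | b.1 ∉ K}
    Eq
    (fun x b => ∃ p : ℝ × ℂ, p.2 ≠ 0 ∧ p ∉ nbhdγ ∧ x = σ.toFun (b.2, p) ∧
      b.1 = ν.toFun ((toSolidTorus p).1, ((b.2 ^ m : Circle) : ℂ) * (toSolidTorus p).2))
    P.surface
    ∅
    Q

end TwistRim

end

/-! The complement of the unknot `γ` in `(ℝ × ℂ) ∪ {∞}` is an open solid torus `S¹ × ℂ`, whose core
is the axis together with `∞`; the complement of `N(γ)` is the part `‖ζ‖ < 2`. Attaching `E(K) × S¹`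
therefore completes each solid torus over `θ ∈ α` to `S³`, with the core becoming `K` and `∞` the
missing point of `K`. So the rim surgery replaces `S¹ × (B³, I)` by a bundle over `S¹` with fibre
`(B³, K₊)`, assembled by rotating the normal discs of `K` `m` times along `α`.

This bundle is the mapping torus of `τ^m`. Rotate the normal discs at speed `angle ζ - 2π`: this
flow is supported in the tube, has speed zero for `‖ζ‖ ≥ 3` and constant speed `-2π` for `‖ζ‖ ≤ 2`,
and its time-one map is `τ` because a full turn is the identity (`flow_one`). Undoing the flow, `(q,
s) ↦ (flow (-ms) q, e^{2πis})`, turns the mapping torus of `τ^m` on `S³` into `S³ × S¹`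
(`untwist_eq_iff`), and near `K` it is the `m`-fold rotation that occurs in `φ` (`untwist_tube`).

Hence a result of the second gluing also satisfies the specification of the first
(`IsRimTorusSurgery.isTwistRimSurgery`). Since a gluing specification determines the pair up to
diffeomorphism (`IsGluing.pairwiseDiffeomorphic`), any two results agree. Existence is needed only
for the second gluing: it comes from a general gluing theorem (`GluingMaps.exists_isManifold`),
whose Hausdorff condition is `mem_of_mem_closure_gluing`. -/

noncomputable section

open Set Filter Topology

/-! ### Local diffeomorphisms: restriction, products, cancellation, inverses. -/

section LocalDiffeo

variable {E₁ E₂ E₃ E₄ : Type*} [NormedAddCommGroup E₁] [NormedSpace ℝ E₁]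
  [NormedAddCommGroup E₂] [NormedSpace ℝ E₂] [NormedAddCommGroup E₃] [NormedSpace ℝ E₃]
  [NormedAddCommGroup E₄] [NormedSpace ℝ E₄]
  {H₁ H₂ H₃ H₄ : Type*} [TopologicalSpace H₁] [TopologicalSpace H₂] [TopologicalSpace H₃]
  [TopologicalSpace H₄]
  {I₁ : ModelWithCorners ℝ E₁ H₁} {I₂ : ModelWithCorners ℝ E₂ H₂} {I₃ : ModelWithCorners ℝ E₃ H₃}
  {I₄ : ModelWithCorners ℝ E₄ H₄}
  {M₁ M₂ M₃ M₄ : Type*} [TopologicalSpace M₁] [ChartedSpace H₁ M₁]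
  [TopologicalSpace M₂] [ChartedSpace H₂ M₂] [TopologicalSpace M₃] [ChartedSpace H₃ M₃]
  [TopologicalSpace M₄] [ChartedSpace H₄ M₄] {n : WithTop ℕ∞}

namespace PartialDiffeomorph

/-- The restriction of a partial diffeomorphism to an open set. -/
def restrOpen (Φ : PartialDiffeomorph I₁ I₂ M₁ M₂ n) (s : Set M₁) (hs : IsOpen s) :
    PartialDiffeomorph I₁ I₂ M₁ M₂ n where
  __ := Φ.toOpenPartialHomeomorph.restrOpen s hs
  contMDiffOn_toFun := Φ.contMDiffOn_toFun.mono inter_subset_left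
  contMDiffOn_invFun := Φ.contMDiffOn_invFun.mono inter_subset_left

/-- The product of two partial diffeomorphisms. -/
def prodMap (Φ : PartialDiffeomorph I₁ I₂ M₁ M₂ n) (Ψ : PartialDiffeomorph I₃ I₄ M₃ M₄ n) :
    PartialDiffeomorph (I₁.prod I₃) (I₂.prod I₄) (M₁ × M₃) (M₂ × M₄) n where
  __ := Φ.toOpenPartialHomeomorph.prod Ψ.toOpenPartialHomeomorph
  contMDiffOn_toFun := Φ.contMDiffOn_toFun.prodMap Ψ.contMDiffOn_toFun
  contMDiffOn_invFun := Φ.contMDiffOn_invFun.prodMap Ψ.contMDiffOn_invFun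

end PartialDiffeomorph

namespace IsLocalDiffeomorphAt

theorem congr_of_eventuallyEq {f g : M₁ → M₂} {x : M₁} (hf : IsLocalDiffeomorphAt I₁ I₂ n f x)
    (h : g =ᶠ[𝓝 x] f) : IsLocalDiffeomorphAt I₁ I₂ n g x := by
  obtain ⟨Φ, hx, hΦ⟩ := hf
  obtain ⟨s, hs, hso, hxs⟩ := eventually_nhds_iff.1 h
  exact ⟨Φ.restrOpen s hso, ⟨hx, hxs⟩, fun y hy => (hs y hy.2).trans (hΦ hy.1)⟩

/-- Near `h x` one has `f = (f ∘ h) ∘ h⁻¹`. This is how maps on a glued space, known only after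
composition with a piece, are shown to be local diffeomorphisms. -/
theorem of_comp {f : M₂ → M₃} {h : M₁ → M₂} {x : M₁}
    (hfh : IsLocalDiffeomorphAt I₁ I₃ n (f ∘ h) x) (hh : IsLocalDiffeomorphAt I₁ I₂ n h x) :
    IsLocalDiffeomorphAt I₂ I₃ n f (h x) := by
  have hx : hh.localInverse (h x) = x := hh.localInverse_left_inv hh.localInverse_mem_target
  have h2 : IsLocalDiffeomorphAt I₁ I₃ n (f ∘ h) (hh.localInverse (h x)) := by rwa [hx]
  have h1 := hh.localInverse_isLocalDiffeomorphAt.comp _ _ h2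
  refine h1.congr_of_eventuallyEq ?_
  filter_upwards [hh.localInverse_eventuallyEq_right] with y hy
  exact (congrArg f hy).symm

theorem prodMap {f : M₁ → M₂} {g : M₃ → M₄} {p : M₁ × M₃}
    (hf : IsLocalDiffeomorphAt I₁ I₂ n f p.1) (hg : IsLocalDiffeomorphAt I₃ I₄ n g p.2) :
    IsLocalDiffeomorphAt (I₁.prod I₃) (I₂.prod I₄) n (Prod.map f g) p := by
  obtain ⟨Φ, hx, hΦ⟩ := hf
  obtain ⟨Ψ, hy, hΨ⟩ := hg
  exact ⟨Φ.prodMap Ψ, ⟨hx, hy⟩, fun q hq => Prod.ext (hΦ hq.1) (hΨ hq.2)⟩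

theorem id (x : M₁) : IsLocalDiffeomorphAt I₁ I₁ n (fun y : M₁ => y) x :=
  (Diffeomorph.refl I₁ M₁ n).isLocalDiffeomorph x

theorem continuousAt {f : M₁ → M₂} {x : M₁} (hf : IsLocalDiffeomorphAt I₁ I₂ n f x) :
    ContinuousAt f x := hf.contMDiffAt.continuousAt

theorem map_nhds_eq {f : M₁ → M₂} {x : M₁} (hf : IsLocalDiffeomorphAt I₁ I₂ n f x) :
    map f (𝓝 x) = 𝓝 (f x) := by
  obtain ⟨Φ, hx, hΦ⟩ := hf
  have h : f =ᶠ[𝓝 x] Φ.toOpenPartialHomeomorph :=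
    eventuallyEq_of_mem (Φ.open_source.mem_nhds hx) hΦ
  rw [map_congr h, hΦ hx]
  exact Φ.toOpenPartialHomeomorph.map_nhds_eq hx

end IsLocalDiffeomorphAt

namespace IsLocalDiffeomorphOn

theorem isOpen_image {f : M₁ → M₂} {s t : Set M₁} (hf : IsLocalDiffeomorphOn I₁ I₂ n f s)
    (ht : IsOpen t) (hts : t ⊆ s) : IsOpen (f '' t) := by
  rw [isOpen_iff_mem_nhds]
  rintro _ ⟨x, hx, rfl⟩
  rw [← (hf ⟨x, hts hx⟩).map_nhds_eq]
  exact image_mem_map (ht.mem_nhds hx)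

/-- An injective local diffeomorphism on an open set, as a partial diffeomorphism. -/
def toPartialDiffeomorph [Nonempty M₁] {f : M₁ → M₂} {s : Set M₁}
    (hf : IsLocalDiffeomorphOn I₁ I₂ n f s) (hs : IsOpen s) (hinj : InjOn f s) :
    PartialDiffeomorph I₁ I₂ M₁ M₂ n where
  __ := hinj.bijOn_image.toPartialEquiv f s (f '' s)
  open_source := hs
  open_target := hf.isOpen_image hs subset_rfl
  contMDiffOn_toFun := hf.contMDiffOn
  contMDiffOn_invFun := by
    rintro _ ⟨x, hx, rfl⟩
    have h := hf ⟨x, hx⟩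
    refine (h.localInverse_contMDiffAt.congr_of_eventuallyEq ?_).contMDiffWithinAt
    -- Neighbourhoods of `f x` are images of neighbourhoods of `x`, so the global and local inverses
    -- need only be compared at points `f y`.
    rw [← h.map_nhds_eq]
    refine eventually_map.2 ?_
    filter_upwards [h.localInverse_eventuallyEq_left, hs.mem_nhds hx] with y hy hys
    exact (hinj.leftInvOn_invFunOn hys).trans hy.symm

end IsLocalDiffeomorphOn

end LocalDiffeo

/-! ### Gluing two manifolds along a partial diffeomorphism. -/

section Glue

variable {E₁ E₂ E : Type*} [NormedAddCommGroup E₁] [NormedSpace ℝ E₁]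
  [NormedAddCommGroup E₂] [NormedSpace ℝ E₂] [NormedAddCommGroup E] [NormedSpace ℝ E]
  {H₁ H₂ H : Type*} [TopologicalSpace H₁] [TopologicalSpace H₂] [TopologicalSpace H]
  {I₁ : ModelWithCorners ℝ E₁ H₁} {I₂ : ModelWithCorners ℝ E₂ H₂} {I : ModelWithCorners ℝ E H}
  {A B Q : Type*} [TopologicalSpace A] [ChartedSpace H₁ A]
  [TopologicalSpace B] [ChartedSpace H₂ B] {n : WithTop ℕ∞}

/-- On the model space the identity is a chart, so membership in the groupoid is compatibility of
`φ` with that chart. -/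
theorem mem_contDiffGroupoid_of_contMDiffOn {φ : OpenPartialHomeomorph H H}
    (h : ContMDiffOn I I n φ φ.source) (h' : ContMDiffOn I I n φ.symm φ.target) :
    φ ∈ contDiffGroupoid n I := by
  have h1 := φ.mem_maximalAtlas_of_contMDiffOn h h'
  have h2 := (contDiffGroupoid n I).compatible_of_mem_maximalAtlas
    (IsManifold.subset_maximalAtlas (I := I) (n := n)
      (show OpenPartialHomeomorph.refl H ∈ atlas H H from rfl)) h1
  simpa using h2

/-- The set `Q` is the union of the open piece `U` of `A` and the open piece `V` of `B`, glued along
the partial diffeomorphism `T`. -/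
structure GluingMaps (T : PartialDiffeomorph I₁ I₂ A B n) (U : Set A) (V : Set B)
    (i : A → Q) (j : B → Q) : Prop where
  isOpen_left : IsOpen U
  isOpen_right : IsOpen V
  source_subset : T.source ⊆ U
  target_subset : T.target ⊆ V
  injOn_left : InjOn i U
  injOn_right : InjOn j V
  eq_iff : ∀ x ∈ U, ∀ y ∈ V, i x = j y ↔ x ∈ T.source ∧ T x = y
  cover : i '' U ∪ j '' V = univ

namespace GluingMaps

variable {T : PartialDiffeomorph I₁ I₂ A B n} {U : Set A} {V : Set B} {i : A → Q} {j : B → Q}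

/-- The quotient topology on the result of a gluing. -/
@[reducible]
def topology (h : GluingMaps T U V i j) : TopologicalSpace Q where
  IsOpen O := IsOpen (U ∩ i ⁻¹' O) ∧ IsOpen (V ∩ j ⁻¹' O)
  isOpen_univ := by simpa using ⟨h.isOpen_left, h.isOpen_right⟩
  isOpen_inter s t hs ht := by
    rw [preimage_inter, preimage_inter, inter_inter_distrib_left U, inter_inter_distrib_left V]
    exact ⟨hs.1.inter ht.1, hs.2.inter ht.2⟩
  isOpen_sUnion s hs := by
    simp only [preimage_sUnion, inter_iUnion]
    exact ⟨isOpen_biUnion fun t ht => (hs t ht).1, isOpen_biUnion fun t ht => (hs t ht).2⟩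

theorem symm (h : GluingMaps T U V i j) : GluingMaps T.symm V U j i where
  isOpen_left := h.isOpen_right
  isOpen_right := h.isOpen_left
  source_subset := h.target_subset
  target_subset := h.source_subset
  injOn_left := h.injOn_right
  injOn_right := h.injOn_left
  eq_iff y hy x hx := by
    rw [eq_comm, h.eq_iff x hx y hy]
    constructor
    · rintro ⟨h1, rfl⟩
      exact ⟨T.map_source h1, T.left_inv h1⟩
    · rintro ⟨h1, rfl⟩
      exact ⟨T.map_target h1, T.right_inv h1⟩
  cover := by rw [union_comm, h.cover]

theorem topology_symm (h : GluingMaps T U V i j) : h.symm.topology = h.topology :=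
  TopologicalSpace.ext (by ext O; exact and_comm)

/-- By injectivity `i '' O` pulls back to `O` on the first piece; on the second it pulls back to the
part of `T.target` that `T⁻¹` sends into `O`. -/
theorem isOpen_image (h : GluingMaps T U V i j) {O : Set A} (hO : IsOpen O) (hOU : O ⊆ U) :
    IsOpen[h.topology] (i '' O) := by
  constructor
  · convert hO using 1
    ext x
    constructor
    · rintro ⟨hx, x', hx', hxx⟩
      exact h.injOn_left (hOU hx') hx hxx ▸ hx'
    · exact fun hx => ⟨hOU hx, x, hx, rfl⟩
  · convert T.symm.toOpenPartialHomeomorph.isOpen_inter_preimage hO using 1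
    ext y
    constructor
    · rintro ⟨hy, x, hx, hxy⟩
      obtain ⟨h1, rfl⟩ := (h.eq_iff x (hOU hx) y hy).1 hxy
      refine ⟨T.map_source h1, ?_⟩
      rwa [mem_preimage, show T.symm.toOpenPartialHomeomorph (T x) = x from T.left_inv h1]
    · rintro ⟨hy, hx⟩
      have hyV := h.target_subset hy
      exact ⟨hyV, _, hx, (h.eq_iff _ (hOU hx) y hyV).2 ⟨T.map_target hy, T.right_inv hy⟩⟩

/-- The inclusion of the first piece. -/
def left [Nonempty A] [t : TopologicalSpace Q] (h : GluingMaps T U V i j)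
    (ht : t = h.topology) : OpenPartialHomeomorph A Q :=
  OpenPartialHomeomorph.ofContinuousOpenRestrict
    (h.injOn_left.bijOn_image.toPartialEquiv i U (i '' U))
    ((continuousOn_open_iff h.isOpen_left).2 fun O hO => by
      rw [ht] at hO
      exact hO.1)
    (by
      rintro _ ⟨O', hO', rfl⟩
      have := h.isOpen_image (hO'.inter h.isOpen_left) inter_subset_right
      rw [← ht] at this
      convert this using 1
      change U.domRestrict i '' (Subtype.val ⁻¹' O') = _
      ext q
      simp only [mem_image, mem_preimage, Subtype.exists, mem_inter_iff]
      tauto)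
    h.isOpen_left

/-- The transition map is `d ∘ S ∘ c⁻¹` wherever it is defined. Taking `S` to be the identity, `T`
or `T.symm` covers all pairs of charts of a gluing. -/
theorem contMDiffOn_transition [TopologicalSpace Q] (S : PartialDiffeomorph I₁ I₂ A B n)
    (ι : OpenPartialHomeomorph A Q) (κ : OpenPartialHomeomorph B Q)
    (hS : ∀ x ∈ ι.source, ι x ∈ κ.target → x ∈ S.source ∧ κ.symm (ι x) = S x)
    (c : PartialDiffeomorph I₁ I A H n) (d : PartialDiffeomorph I₂ I B H n) :
    ContMDiffOn I I n ((ι.symm.trans c.toOpenPartialHomeomorph).symm.trans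
        (κ.symm.trans d.toOpenPartialHomeomorph))
      ((ι.symm.trans c.toOpenPartialHomeomorph).symm.trans
        (κ.symm.trans d.toOpenPartialHomeomorph)).source := by
  have key : ∀ y ∈ ((ι.symm.trans c.toOpenPartialHomeomorph).symm.trans
        (κ.symm.trans d.toOpenPartialHomeomorph)).source,
      y ∈ (c.symm.trans (S.trans d)).source ∧
      ((ι.symm.trans c.toOpenPartialHomeomorph).symm.trans
        (κ.symm.trans d.toOpenPartialHomeomorph)) y = (c.symm.trans (S.trans d)) y := by
    rintro y ⟨⟨hy1, hy2⟩, hy3, hy4⟩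
    have hS' := hS _ hy2 hy3
    refine ⟨⟨hy1, hS'.1, ?_⟩, congrArg d hS'.2⟩
    have hy5 : κ.symm (ι (c.symm y)) ∈ d.source := hy4
    rw [show κ.symm (ι (c.symm y)) = _ from hS'.2] at hy5
    exact hy5
  exact ((c.symm.trans (S.trans d)).contMDiffOn_toFun.mono fun y hy => (key y hy).1).congr
    fun y hy => (key y hy).2

/-- The hypothesis `hT` says that the graph of `T` is closed in `U × V`. A product neighbourhood of
`(x, y)` missing the graph has factors with disjoint images; two points of the same piece are
separated inside it. -/
theorem t2Space [T2Space A] [T2Space B] [TopologicalSpace Q] (h : GluingMaps T U V i j)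
    (hT : ∀ x ∈ U, ∀ y ∈ V,
      (x, y) ∈ closure {p : A × B | p.1 ∈ T.source ∧ T p.1 = p.2} → x ∈ T.source ∧ T x = y)
    (hi : ∀ O ⊆ U, IsOpen O → IsOpen (i '' O)) (hj : ∀ O ⊆ V, IsOpen O → IsOpen (j '' O)) :
    T2Space Q := by
  have hU : ∀ x ∈ U, ∀ x' ∈ U, i x ≠ i x' →
      ∃ u v : Set Q, IsOpen u ∧ IsOpen v ∧ i x ∈ u ∧ i x' ∈ v ∧ Disjoint u v := by
    intro x hx x' hx' hne
    obtain ⟨u, v, hu, hv, hxu, hxv, huv⟩ := t2_separation (fun e => hne (congrArg i e))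
    refine ⟨i '' (U ∩ u), i '' (U ∩ v), hi _ inter_subset_left (h.isOpen_left.inter hu),
      hi _ inter_subset_left (h.isOpen_left.inter hv), ⟨x, ⟨hx, hxu⟩, rfl⟩, ⟨x', ⟨hx', hxv⟩, rfl⟩, ?_⟩
    rw [disjoint_left]
    rintro _ ⟨a, ha, rfl⟩ ⟨b, hb, hab⟩
    exact disjoint_left.1 huv ha.2 (h.injOn_left hb.1 ha.1 hab ▸ hb.2)
  have hV : ∀ x ∈ V, ∀ x' ∈ V, j x ≠ j x' →
      ∃ u v : Set Q, IsOpen u ∧ IsOpen v ∧ j x ∈ u ∧ j x' ∈ v ∧ Disjoint u v := by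
    intro x hx x' hx' hne
    obtain ⟨u, v, hu, hv, hxu, hxv, huv⟩ := t2_separation (fun e => hne (congrArg j e))
    refine ⟨j '' (V ∩ u), j '' (V ∩ v), hj _ inter_subset_left (h.isOpen_right.inter hu),
      hj _ inter_subset_left (h.isOpen_right.inter hv), ⟨x, ⟨hx, hxu⟩, rfl⟩, ⟨x', ⟨hx', hxv⟩, rfl⟩, ?_⟩
    rw [disjoint_left]
    rintro _ ⟨a, ha, rfl⟩ ⟨b, hb, hab⟩
    exact disjoint_left.1 huv ha.2 (h.injOn_right hb.1 ha.1 hab ▸ hb.2)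
  have hUV : ∀ x ∈ U, ∀ y ∈ V, i x ≠ j y →
      ∃ u v : Set Q, IsOpen u ∧ IsOpen v ∧ i x ∈ u ∧ j y ∈ v ∧ Disjoint u v := by
    intro x hx y hy hne
    have hxy : (x, y) ∉ closure {p : A × B | p.1 ∈ T.source ∧ T p.1 = p.2} :=
      fun hc => hne ((h.eq_iff x hx y hy).2 (hT x hx y hy hc))
    obtain ⟨u, hu, v, hv, huv⟩ := mem_nhds_prod_iff.1 (isClosed_closure.isOpen_compl.mem_nhds hxy)
    obtain ⟨u', hu', hu'o, hxu'⟩ := mem_nhds_iff.1 hu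
    obtain ⟨v', hv', hv'o, hyv'⟩ := mem_nhds_iff.1 hv
    refine ⟨i '' (U ∩ u'), j '' (V ∩ v'), hi _ inter_subset_left (h.isOpen_left.inter hu'o),
      hj _ inter_subset_left (h.isOpen_right.inter hv'o), ⟨x, ⟨hx, hxu'⟩, rfl⟩,
      ⟨y, ⟨hy, hyv'⟩, rfl⟩, ?_⟩
    rw [disjoint_left]
    rintro _ ⟨a, ha, rfl⟩ ⟨b, hb, hab⟩
    exact huv (mk_mem_prod (hu' ha.2) (hv' hb.2))
      (subset_closure ((h.eq_iff a ha.1 b hb.1).1 hab.symm))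
  refine ⟨fun p q hpq => ?_⟩
  have hp : p ∈ i '' U ∪ j '' V := h.cover ▸ mem_univ p
  have hq : q ∈ i '' U ∪ j '' V := h.cover ▸ mem_univ q
  rcases hp with ⟨x, hx, rfl⟩ | ⟨x, hx, rfl⟩ <;> rcases hq with ⟨y, hy, rfl⟩ | ⟨y, hy, rfl⟩
  · exact hU x hx y hy hpq
  · exact hUV x hx y hy hpq
  · obtain ⟨u, v, hu, hv, hxu, hxv, huv⟩ := hUV y hy x hx hpq.symm
    exact ⟨v, u, hv, hu, hxv, hxu, huv.symm⟩
  · exact hV x hx y hy hpq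

/-- Near `x` the inclusion is `c` followed by the inverse of the chart `c ∘ ι⁻¹`. -/
theorem isLocalDiffeomorphAt_of_mem_atlas [TopologicalSpace Q] [ChartedSpace H Q]
    [IsManifold I n Q] (ι : OpenPartialHomeomorph A Q) (c : PartialDiffeomorph I₁ I A H n)
    (hc : ι.symm.trans c.toOpenPartialHomeomorph ∈ atlas H Q) {x : A} (hx : x ∈ ι.source)
    (hxc : x ∈ c.source) : IsLocalDiffeomorphAt I₁ I n ι x := by
  have hm := IsManifold.subset_maximalAtlas (I := I) (n := n) hc
  let Ψ : PartialDiffeomorph I I H Q n :=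
    { __ := (ι.symm.trans c.toOpenPartialHomeomorph).symm
      contMDiffOn_toFun := contMDiffOn_symm_of_mem_maximalAtlas hm
      contMDiffOn_invFun := contMDiffOn_of_mem_maximalAtlas hm }
  have h1 : IsLocalDiffeomorphAt I I n Ψ (c x) := by
    refine ⟨Ψ, ⟨c.map_source hxc, ?_⟩, fun _ _ => rfl⟩
    change c.symm (c x) ∈ ι.source
    rwa [show c.symm (c x) = x from c.left_inv hxc]
  have h2 := (c.isLocalDiffeomorphAt _ _ _ hxc).comp _ _ h1
  refine h2.congr_of_eventuallyEq ?_
  filter_upwards [c.open_source.mem_nhds hxc] with y hy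
  exact (congrArg ι (c.left_inv hy)).symm

/-- The two pieces may have different model spaces, so `hA` and `hB` supply charts into a common
one. The atlas of `Q` consists of these charts precomposed with `i⁻¹` and `j⁻¹`. -/
theorem exists_isManifold [Nonempty A] [Nonempty B] [T2Space A] [T2Space B]
    [SecondCountableTopology A] [SecondCountableTopology B] (h : GluingMaps T U V i j)
    (hA : ∀ x : A, ∃ c : PartialDiffeomorph I₁ I A H n, x ∈ c.source)
    (hB : ∀ y : B, ∃ d : PartialDiffeomorph I₂ I B H n, y ∈ d.source)
    (hT : ∀ x ∈ U, ∀ y ∈ V,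
      (x, y) ∈ closure {p : A × B | p.1 ∈ T.source ∧ T p.1 = p.2} → x ∈ T.source ∧ T x = y) :
    ∃ (_ : TopologicalSpace Q) (_ : ChartedSpace H Q), IsManifold I n Q ∧ T2Space Q ∧
      SecondCountableTopology Q ∧ IsLocalDiffeomorphOn I₁ I n i U ∧
      IsLocalDiffeomorphOn I₂ I n j V := by
  let _ : TopologicalSpace Q := h.topology
  let ι := h.left rfl
  -- The topology defined from either side is the same, which lets both inclusions be open
  -- embeddings for one topology.
  let κ := h.symm.left h.topology_symm.symm
  choose c hc using hA
  choose d hd using hB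
  have hex : ∀ q : Q, ∃ e : OpenPartialHomeomorph Q H, q ∈ e.source ∧
      ((∃ c : PartialDiffeomorph I₁ I A H n, e = ι.symm.trans c.toOpenPartialHomeomorph) ∨
        ∃ d : PartialDiffeomorph I₂ I B H n, e = κ.symm.trans d.toOpenPartialHomeomorph) := by
    intro q
    have hq : q ∈ i '' U ∪ j '' V := h.cover ▸ mem_univ q
    rcases hq with ⟨x, hx, rfl⟩ | ⟨y, hy, rfl⟩
    · refine ⟨ι.symm.trans (c x).toOpenPartialHomeomorph, ⟨⟨x, hx, rfl⟩, ?_⟩, Or.inl ⟨c x, rfl⟩⟩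
      have h1 : ι.symm (i x) = x := ι.left_inv hx
      change ι.symm (i x) ∈ (c x).source
      rw [h1]
      exact hc x
    · refine ⟨κ.symm.trans (d y).toOpenPartialHomeomorph, ⟨⟨y, hy, rfl⟩, ?_⟩, Or.inr ⟨d y, rfl⟩⟩
      have h1 : κ.symm (j y) = y := κ.left_inv hy
      change κ.symm (j y) ∈ (d y).source
      rw [h1]
      exact hd y
  choose e he he' using hex
  let _ : ChartedSpace H Q :=
    { atlas := {e | (∃ c : PartialDiffeomorph I₁ I A H n,
          e = ι.symm.trans c.toOpenPartialHomeomorph) ∨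
        ∃ d : PartialDiffeomorph I₂ I B H n, e = κ.symm.trans d.toOpenPartialHomeomorph}
      chartAt := e
      mem_chart_source := he
      chart_mem_atlas := he' }
  have hcomp : ∀ e ∈ atlas H Q, ∀ e' ∈ atlas H Q,
      ContMDiffOn I I n (e.symm.trans e') (e.symm.trans e').source := by
    rintro e (⟨c, rfl⟩ | ⟨d, rfl⟩) e' (⟨c', rfl⟩ | ⟨d', rfl⟩)
    · exact contMDiffOn_transition (Diffeomorph.refl I₁ A n).toPartialDiffeomorph ι ι
        (fun x hx _ => ⟨mem_univ _, ι.left_inv hx⟩) c c'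
    · refine contMDiffOn_transition T ι κ ?_ c d'
      rintro x hx ⟨y, hy, hxy⟩
      obtain ⟨h1, rfl⟩ := (h.eq_iff x hx y hy).1 hxy.symm
      refine ⟨h1, ?_⟩
      rw [← show j (T x) = ι x from hxy]
      exact κ.left_inv hy
    · refine contMDiffOn_transition T.symm κ ι ?_ d c'
      rintro y hy ⟨x, hx, hxy⟩
      obtain ⟨h1, rfl⟩ := (h.symm.eq_iff y hy x hx).1 hxy.symm
      refine ⟨h1, ?_⟩
      rw [← show i (T.symm y) = κ y from hxy]
      exact ι.left_inv hx
    · exact contMDiffOn_transition (Diffeomorph.refl I₂ B n).toPartialDiffeomorph κ κ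
        (fun x hx _ => ⟨mem_univ _, κ.left_inv hx⟩) d d'
  have : HasGroupoid Q (contDiffGroupoid n I) :=
    ⟨fun {e e'} he he' => mem_contDiffGroupoid_of_contMDiffOn (hcomp e he e' he')
      (by simpa using hcomp e' he' e he)⟩
  have : IsManifold I n Q := { }
  refine ⟨inferInstance, inferInstance, inferInstance, ?_, ?_, ?_, ?_⟩
  · refine h.t2Space hT (fun O hOU hO => h.isOpen_image hO hOU) fun O hOV hO => ?_
    have := h.symm.isOpen_image hO hOV
    rwa [h.topology_symm] at this
  · have hcov : ⋃ b : Bool, (bif b then i '' U else j '' V) = univ := by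
      rw [← h.cover, union_eq_iUnion]
    have h1 : SecondCountableTopology (i '' U) :=
      ι.symm.secondCountableTopology_source
    have h2 : SecondCountableTopology (j '' V) :=
      κ.symm.secondCountableTopology_source
    have h3 : ∀ b : Bool, SecondCountableTopology ↥(bif b then i '' U else j '' V) := by
      rintro (_ | _)
      · exact h2
      · exact h1
    refine TopologicalSpace.secondCountableTopology_of_countable_cover ?_ hcov
    rintro (_ | _)
    · exact κ.open_target
    · exact ι.open_target
  · rintro ⟨x, hx⟩
    exact isLocalDiffeomorphAt_of_mem_atlas ι (c x) (Or.inl ⟨_, rfl⟩) hx (hc x)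
  · rintro ⟨y, hy⟩
    exact isLocalDiffeomorphAt_of_mem_atlas κ (d y) (Or.inr ⟨_, rfl⟩) hy (hd y)

end GluingMaps

end Glue

/-! ### The underlying set of a gluing. -/

namespace GluingMaps

variable {E₁ E₂ : Type*} [NormedAddCommGroup E₁] [NormedSpace ℝ E₁]
  [NormedAddCommGroup E₂] [NormedSpace ℝ E₂]
  {H₁ H₂ : Type*} [TopologicalSpace H₁] [TopologicalSpace H₂]
  {I₁ : ModelWithCorners ℝ E₁ H₁} {I₂ : ModelWithCorners ℝ E₂ H₂}

open Classical in
-- No quotient is needed: `U` together with `V \ T.target` is a set of representatives, and `j`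
-- sends a point of `T.target` to its partner in `U`.
theorem exists_of_partialDiffeomorph {A : Type u} {B : Type} [TopologicalSpace A]
    [ChartedSpace H₁ A] [TopologicalSpace B] [ChartedSpace H₂ B] {n : WithTop ℕ∞}
    (T : PartialDiffeomorph I₁ I₂ A B n) {U : Set A} {V : Set B} (hU : IsOpen U) (hV : IsOpen V)
    (hTU : T.source ⊆ U) (hTV : T.target ⊆ V) (hne : U.Nonempty) :
    ∃ (Q : Type u) (i : A → Q) (j : B → Q), GluingMaps T U V i j := by
  obtain ⟨x₀, hx₀⟩ := hne
  let Q : Type u := {s : A ⊕ B // s ∈ Sum.inl '' U ∪ Sum.inr '' (V \ T.target)}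
  -- The point `x₀` is only a default value off `U`.
  let i : A → Q := fun x =>
    if h : x ∈ U then ⟨Sum.inl x, Or.inl ⟨x, h, rfl⟩⟩ else ⟨Sum.inl x₀, Or.inl ⟨x₀, hx₀, rfl⟩⟩
  let j : B → Q := fun y =>
    if h : y ∈ V \ T.target then ⟨Sum.inr y, Or.inr ⟨y, h, rfl⟩⟩ else i (T.symm y)
  have hi : ∀ x ∈ U, (i x).1 = Sum.inl x := fun x hx => by simp [i, hx]
  have hj : ∀ y ∈ V, y ∉ T.target → (j y).1 = Sum.inr y := fun y hy hy' => by simp [j, hy, hy']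
  have hj' : ∀ y ∈ T.target, (j y).1 = Sum.inl (T.symm y) := fun y hy => by
    have : j y = i (T.symm y) := by simp [j, hy]
    rw [this]
    exact hi _ (hTU (T.map_target hy))
  refine ⟨Q, i, j, hU, hV, hTU, hTV, ?_, ?_, ?_, ?_⟩
  · intro x hx x' hx' h
    have h1 := congrArg Subtype.val h
    rw [hi x hx, hi x' hx'] at h1
    exact Sum.inl_injective h1
  · intro y hy y' hy' h
    have h1 := congrArg Subtype.val h
    by_cases hyT : y ∈ T.target <;> by_cases hyT' : y' ∈ T.target
    · rw [hj' y hyT, hj' y' hyT'] at h1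
      exact T.symm.injOn hyT hyT' (Sum.inl_injective h1)
    · rw [hj' y hyT, hj y' hy' hyT'] at h1
      cases h1
    · rw [hj y hy hyT, hj' y' hyT'] at h1
      cases h1
    · rw [hj y hy hyT, hj y' hy' hyT'] at h1
      exact Sum.inr_injective h1
  · intro x hx y hy
    rw [Subtype.ext_iff, hi x hx]
    by_cases hyT : y ∈ T.target
    · rw [hj' y hyT, Sum.inl.injEq]
      constructor
      · rintro rfl
        exact ⟨T.map_target hyT, T.right_inv hyT⟩
      · rintro ⟨h1, rfl⟩
        exact (T.left_inv h1).symm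
    · rw [hj y hy hyT]
      refine ⟨fun h => absurd h Sum.inl_ne_inr, ?_⟩
      rintro ⟨h1, rfl⟩
      exact absurd (T.map_source h1) hyT
  · refine eq_univ_of_forall ?_
    rintro ⟨_, ⟨x, hx, rfl⟩ | ⟨y, hy, rfl⟩⟩
    · exact Or.inl ⟨x, hx, Subtype.ext (hi x hx)⟩
    · exact Or.inr ⟨y, hy.1, Subtype.ext (hj y hy.1 hy.2)⟩

end GluingMaps

/-! ### Surfaces in a gluing, and uniqueness of gluings. -/

namespace TwistRim

theorem mem_maximalAtlas_symm {H E : Type*} [TopologicalSpace H] [NormedAddCommGroup E]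
    [NormedSpace ℝ E] {I : ModelWithCorners ℝ E H} {X : Type*} [TopologicalSpace X]
    [ChartedSpace H X] [IsManifold I ∞ X] (Φ : PartialDiffeomorph I I X H ∞) :
    Φ.toOpenPartialHomeomorph ∈ IsManifold.maximalAtlas I ∞ X :=
  Φ.toOpenPartialHomeomorph.mem_maximalAtlas_of_contMDiffOn Φ.contMDiffOn_toFun
    Φ.contMDiffOn_invFun

/-- Slice charts are carried over by `i⁻¹`. Closedness has to be assumed, since an open embedding
need not preserve it. -/
theorem IsEmbeddedSurface.image {X Y : Type*} [Nonempty X] [TopologicalSpace X]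
    [ChartedSpace (EuclideanSpace ℝ (Fin 4)) X] [TopologicalSpace Y]
    [ChartedSpace (EuclideanSpace ℝ (Fin 4)) Y] [IsManifold (𝓡 4) ∞ Y]
    {S U : Set X} {i : X → Y} (hS : IsEmbeddedSurface S) (hU : IsOpen U)
    (hi : IsLocalDiffeomorphOn (𝓡 4) (𝓡 4) ∞ i U) (hinj : InjOn i U)
    (hcl : IsClosed (i '' (S ∩ U))) : IsEmbeddedSurface (i '' (S ∩ U)) := by
  refine ⟨hcl, ?_⟩
  rintro _ ⟨x, ⟨hxS, hxU⟩, rfl⟩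
  obtain ⟨e, he, hxe, hes⟩ := hS.2 x hxS
  let c : PartialDiffeomorph (𝓡 4) (𝓡 4) X (EuclideanSpace ℝ (Fin 4)) ∞ :=
    { __ := e
      contMDiffOn_toFun := contMDiffOn_of_mem_maximalAtlas he
      contMDiffOn_invFun := contMDiffOn_symm_of_mem_maximalAtlas he }
  let Φ := hi.toPartialDiffeomorph hU hinj
  have hΦ : ∀ z ∈ U, Φ.symm (i z) = z := fun z hz => Φ.left_inv hz
  refine ⟨(Φ.symm.trans c).toOpenPartialHomeomorph, mem_maximalAtlas_symm _, ⟨⟨x, hxU, rfl⟩, ?_⟩, ?_⟩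
  · change Φ.symm (i x) ∈ e.source
    rwa [hΦ x hxU]
  · rintro _ ⟨⟨z, hz, rfl⟩, hze⟩
    change Φ.symm (i z) ∈ e.source at hze
    change _ ↔ (e (Φ.symm (i z))) 2 = 0 ∧ (e (Φ.symm (i z))) 3 = 0
    rw [hΦ z hz] at hze ⊢
    rw [← hes z hze]
    constructor
    · rintro ⟨z', hz', h⟩
      exact hinj hz'.2 hz h ▸ hz'.1
    · exact fun h => ⟨z, ⟨h, hz⟩, rfl⟩

section Uniqueness

variable {A B Q Q' : Type*} {U : Set A} {V : Set B} {i : A → Q} {j : B → Q} {i' : A → Q'}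
  {j' : B → Q'} {r : B → B → Prop} {g : A → B → Prop}

/-- The primed maps make the same identifications, so `i a ↦ i' a`, `j b ↦ j' b` is well defined. -/
theorem exists_map_of_same_gluing (hi : InjOn i U) (hj : ∀ b ∈ V, ∀ b' ∈ V, j b = j b' ↔ r b b')
    (hij : ∀ a ∈ U, ∀ b ∈ V, i a = j b ↔ g a b) (hcov : i '' U ∪ j '' V = univ)
    (hj' : ∀ b ∈ V, ∀ b' ∈ V, j' b = j' b' ↔ r b b')
    (hij' : ∀ a ∈ U, ∀ b ∈ V, i' a = j' b ↔ g a b) :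
    ∃ f : Q → Q', (∀ a ∈ U, f (i a) = i' a) ∧ ∀ b ∈ V, f (j b) = j' b := by
  have hex : ∀ q, ∃ q', (∃ a ∈ U, i a = q ∧ i' a = q') ∨ ∃ b ∈ V, j b = q ∧ j' b = q' := by
    intro q
    have hq : q ∈ i '' U ∪ j '' V := hcov ▸ mem_univ q
    rcases hq with ⟨a, ha, rfl⟩ | ⟨b, hb, rfl⟩
    · exact ⟨i' a, Or.inl ⟨a, ha, rfl, rfl⟩⟩
    · exact ⟨j' b, Or.inr ⟨b, hb, rfl, rfl⟩⟩
  choose f hf using hex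
  refine ⟨f, fun a ha => ?_, fun b hb => ?_⟩
  · rcases hf (i a) with ⟨a', ha', h1, h2⟩ | ⟨b, hb, h1, h2⟩
    · rw [← h2, hi ha' ha h1]
    · rw [← h2]
      exact ((hij' a ha b hb).2 ((hij a ha b hb).1 h1.symm)).symm
  · rcases hf (j b) with ⟨a, ha, h1, h2⟩ | ⟨b', hb', h1, h2⟩
    · rw [← h2]
      exact (hij' a ha b hb).2 ((hij a ha b hb).1 h1)
    · rw [← h2]
      exact (hj' b' hb' b hb).2 ((hj b' hb' b hb).1 h1)

end Uniqueness

/-- The result of a gluing is determined up to pairwise diffeomorphism. -/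
theorem IsGluing.pairwiseDiffeomorphic {EA HA EB HB : Type} [NormedAddCommGroup EA]
    [NormedSpace ℝ EA] [TopologicalSpace HA] [NormedAddCommGroup EB] [NormedSpace ℝ EB]
    [TopologicalSpace HB] {IA : ModelWithCorners ℝ EA HA} {IB : ModelWithCorners ℝ EB HB}
    {A : Type u} [TopologicalSpace A] [ChartedSpace HA A]
    {B : Type} [TopologicalSpace B] [ChartedSpace HB B]
    {U : Set A} {V : Set B} {r : B → B → Prop} {g : A → B → Prop} {SA : Set A} {SB : Set B}
    {Q Q' : SurfacePair.{u}} (hU : IsOpen U) (hV : IsOpen V)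
    (h : IsGluing IA IB U V r g SA SB Q) (h' : IsGluing IA IB U V r g SA SB Q') :
    PairwiseDiffeomorphic Q Q' := by
  obtain ⟨i, j, hil, hjl, hi, hj, hij, hcov, hS⟩ := h
  obtain ⟨i', j', hil', hjl', hi', hj', hij', hcov', hS'⟩ := h'
  obtain ⟨f, hfi, hfj⟩ := exists_map_of_same_gluing hi hj hij hcov hj' hij'
  obtain ⟨f', hfi', hfj'⟩ := exists_map_of_same_gluing hi' hj' hij' hcov' hj hij
  have hl : Function.LeftInverse f' f := by
    intro q
    have hq : q ∈ i '' U ∪ j '' V := hcov ▸ mem_univ q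
    rcases hq with ⟨a, ha, rfl⟩ | ⟨b, hb, rfl⟩
    · rw [hfi a ha, hfi' a ha]
    · rw [hfj b hb, hfj' b hb]
  have hr : Function.RightInverse f' f := by
    intro q
    have hq : q ∈ i' '' U ∪ j' '' V := hcov' ▸ mem_univ q
    rcases hq with ⟨a, ha, rfl⟩ | ⟨b, hb, rfl⟩
    · rw [hfi' a ha, hfi a ha]
    · rw [hfj' b hb, hfj b hb]
  -- On each open piece `f` composed with the inclusion is the primed inclusion, so the inclusion
  -- can be cancelled.
  have hf : IsLocalDiffeomorph (𝓡 4) (𝓡 4) ∞ f := by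
    intro q
    have hq : q ∈ i '' U ∪ j '' V := hcov ▸ mem_univ q
    rcases hq with ⟨a, ha, rfl⟩ | ⟨b, hb, rfl⟩
    · refine IsLocalDiffeomorphAt.of_comp ((hil' ⟨a, ha⟩).congr_of_eventuallyEq ?_) (hil ⟨a, ha⟩)
      exact eventuallyEq_of_mem (hU.mem_nhds ha) hfi
    · refine IsLocalDiffeomorphAt.of_comp ((hjl' ⟨b, hb⟩).congr_of_eventuallyEq ?_) (hjl ⟨b, hb⟩)
      exact eventuallyEq_of_mem (hV.mem_nhds hb) hfj
  refine ⟨hf.diffeomorphOfBijective ⟨hl.injective, hr.surjective⟩, ?_⟩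
  change f '' Q.surface = Q'.surface
  rw [hS, hS', image_union, image_image, image_image]
  exact congrArg₂ _ (image_congr fun a ha => hfi a ha.2) (image_congr fun b hb => hfj b hb.2)

/-! ### The circle -/

theorem coe_exp_arg {w : ℂ} (hw : w ≠ 0) : (Circle.exp w.arg : ℂ) = w / ‖w‖ := by
  rw [Circle.coe_exp, eq_div_iff (by simpa using hw), mul_comm]
  exact Complex.norm_mul_exp_arg_mul_I w

theorem contMDiff_circle_coe {n : WithTop ℕ∞} :
    ContMDiff (𝓡 1) 𝓘(ℝ, ℂ) n (fun c : Circle => (c : ℂ)) :=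
  have := finrank_real_complex_fact'
  contMDiff_coe_sphere (E := ℂ) (n := 1)

theorem contDiffAt_arg {w : ℂ} (hw : w ∈ Complex.slitPlane) : ContDiffAt ℝ ∞ Complex.arg w := by
  have h1 : ContDiffAt ℝ ∞ Complex.log w := (Complex.contDiffAt_log hw).restrict_scalars ℝ
  have h2 := Complex.imCLM.contDiff.contDiffAt.comp w h1 (n := ∞)
  refine h2.congr_of_eventuallyEq (Eventually.of_forall fun z => ?_)
  simp [Complex.log_im]

/-- `arg` jumps on the negative axis, but its exponential does not: near `w` use `arg (z / w)`,
which stays away from the cut, and multiply by the constant `exp (arg w)`. -/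
theorem contMDiffAt_exp_arg {w : ℂ} (hw : w ≠ 0) :
    ContMDiffAt 𝓘(ℝ, ℂ) (𝓡 1) ∞ (fun z : ℂ => Circle.exp z.arg) w := by
  have h1 : ContDiffAt ℝ ∞ (fun z : ℂ => (z / w).arg) w := by
    refine ContDiffAt.comp w (g := Complex.arg) (f := fun z : ℂ => z / w) (contDiffAt_arg ?_)
      (contDiffAt_id.div_const w)
    simp [hw]
  have h2 : ContMDiffAt 𝓘(ℝ, ℂ) (𝓡 1) ∞ (fun z : ℂ => Circle.exp (z / w).arg) w :=
    (contMDiff_circleExp (m := ∞)).contMDiffAt.comp w h1.contMDiffAt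
  have h3 : ContMDiffAt 𝓘(ℝ, ℂ) (𝓡 1) ∞ (fun z : ℂ => Circle.exp (z / w).arg * Circle.exp w.arg) w :=
    h2.mul contMDiffAt_const
  refine h3.congr_of_eventuallyEq ?_
  filter_upwards [isOpen_ne.mem_nhds hw] with z hz
  ext
  rw [Circle.coe_mul, coe_exp_arg hz, coe_exp_arg hw, coe_exp_arg (div_ne_zero hz hw), norm_div]
  have : (‖w‖ : ℂ) ≠ 0 := by simpa using hw
  have : (‖z‖ : ℂ) ≠ 0 := by simpa using hz
  push_cast
  field_simp

/-- The covering `ℝ → S¹` of period `1`. -/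
def cover (s : ℝ) : Circle := Circle.exp (2 * Real.pi * s)

theorem cover_add (s t : ℝ) : cover (s + t) = cover s * cover t := by
  rw [cover, mul_add, Circle.exp_add, cover, cover]

theorem cover_int (k : ℤ) : cover k = 1 := by
  rw [cover, mul_comm]
  exact Circle.exp_int_mul_two_pi k

theorem cover_eq_iff {s t : ℝ} : cover s = cover t ↔ ∃ k : ℤ, t = s + k := by
  constructor
  · intro h
    obtain ⟨k, hk⟩ := Circle.exp_eq_exp.1 h.symm
    refine ⟨k, ?_⟩
    have := Real.two_pi_pos
    have h2 : 2 * Real.pi * t = 2 * Real.pi * (s + k) := by rw [hk]; ring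
    exact mul_left_cancel₀ this.ne' h2
  · rintro ⟨k, rfl⟩
    rw [cover_add, cover_int, mul_one]

theorem cover_surjective : Function.Surjective cover := by
  intro c
  refine ⟨(c : ℂ).arg / (2 * Real.pi), ?_⟩
  rw [cover, mul_div_cancel₀ _ Real.two_pi_pos.ne', Circle.exp_arg]

theorem contMDiff_cover : ContMDiff 𝓘(ℝ, ℝ) (𝓡 1) ∞ cover :=
  contMDiff_circleExp.comp (contDiff_const.mul contDiff_id).contMDiff

theorem isLocalDiffeomorph_cover : IsLocalDiffeomorph 𝓘(ℝ, ℝ) (𝓡 1) ∞ cover := by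
  intro s₀
  have hpi := Real.pi_pos
  -- Multiplication by `cover (-s₀)` moves `cover s₀` to `1`, away from the cut, so `arg` inverts
  -- `cover` on the interval of length 1 about `s₀`.
  have harg : ∀ s : ℝ, |s - s₀| < 1 / 2 →
      ((cover s * cover (-s₀) : Circle) : ℂ).arg = 2 * Real.pi * (s - s₀) := by
    intro s hs
    obtain ⟨h1, h2⟩ := abs_lt.1 hs
    rw [← cover_add, ← sub_eq_add_neg, cover, Circle.arg_exp] <;> nlinarith
  have hinv : ∀ c : Circle, cover (s₀ + ((c * cover (-s₀) : Circle) : ℂ).arg / (2 * Real.pi)) = c := by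
    intro c
    rw [cover_add]
    nth_rw 2 [cover]
    rw [mul_div_cancel₀ _ Real.two_pi_pos.ne', Circle.exp_arg, mul_comm, mul_assoc, ← cover_add]
    simp [cover]
  refine ⟨{ toFun := cover
            invFun := fun c => s₀ + ((c * cover (-s₀) : Circle) : ℂ).arg / (2 * Real.pi)
            source := {s | |s - s₀| < 1 / 2}
            target := {c | ((c * cover (-s₀) : Circle) : ℂ) ∈ Complex.slitPlane}
            map_source' := ?_
            map_target' := ?_
            left_inv' := ?_
            right_inv' := fun c _ => hinv c
            open_source := isOpen_lt (by fun_prop) continuous_const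
            open_target := ?_
            contMDiffOn_toFun := contMDiff_cover.contMDiffOn
            contMDiffOn_invFun := ?_ }, ?_, fun _ _ => rfl⟩
  · intro s hs
    rw [mem_ofPred_eq, Complex.mem_slitPlane_iff_arg, harg s hs]
    obtain ⟨h1, h2⟩ := abs_lt.1 (show |s - s₀| < 1 / 2 from hs)
    exact ⟨by nlinarith, Circle.coe_ne_zero _⟩
  · intro c hc
    have h1 := (Complex.mem_slitPlane_iff_arg.1 hc).1
    have h2 := Complex.neg_pi_lt_arg ((c * cover (-s₀) : Circle) : ℂ)
    have h3 := (Complex.arg_le_pi ((c * cover (-s₀) : Circle) : ℂ)).lt_of_ne h1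
    rw [mem_ofPred_eq, add_sub_cancel_left, abs_lt, lt_div_iff₀ (by positivity),
      div_lt_iff₀ (by positivity)]
    constructor <;> linarith
  · intro s hs
    rw [harg s hs]
    field_simp
    ring
  · exact Complex.isOpen_slitPlane.preimage (by fun_prop)
  · intro c hc
    have h1 : ContMDiffAt (𝓡 1) 𝓘(ℝ, ℂ) ∞ (fun c : Circle => ((c * cover (-s₀) : Circle) : ℂ)) c :=
      contMDiff_circle_coe.contMDiffAt.comp c (contMDiffAt_id.mul contMDiffAt_const)
    have h2 := (contDiffAt_arg hc).contMDiffAt.comp c h1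
    have h3 : ContDiff ℝ ∞ (fun x : ℝ => s₀ + x / (2 * Real.pi)) := by fun_prop
    exact (h3.contMDiff.contMDiffAt.comp c h2).contMDiffWithinAt
  · simp

/-! ### The solid torus -/

theorem norm_winding_sq (p : ℝ × ℂ) :
    ‖winding p‖ ^ 2 = (p.1 ^ 2 + ‖p.2‖ ^ 2 + 1) ^ 2 - 4 * ‖p.2‖ ^ 2 := by
  rw [← Complex.normSq_eq_norm_sq, Complex.normSq_apply, winding]
  ring

theorem contDiff_winding : ContDiff ℝ ∞ winding := by
  have h : ContDiff ℝ ∞ (fun p : ℝ × ℂ =>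
      ((p.1 ^ 2 + ‖p.2‖ ^ 2 - 1 : ℝ) : ℂ) + ((-2 * p.1 : ℝ) : ℂ) * Complex.I) := by
    have h1 : ContDiff ℝ ∞ (fun p : ℝ × ℂ => ‖p.2‖ ^ 2) := contDiff_snd.norm_sq ℝ
    have h2 : ContDiff ℝ ∞ (fun x : ℝ => (x : ℂ)) := Complex.ofRealCLM.contDiff
    refine (h2.comp ?_).add ((h2.comp ?_).mul contDiff_const) <;> fun_prop
  convert h using 1
  ext p
  rw [winding, Complex.mk_eq_add_mul_I]

/-- The denominator of the inverse of `toSolidTorus`. -/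
def denom (q : Circle × ℂ) : ℝ := √(1 + ‖q.2‖ ^ 2) - (q.1 : ℂ).re

/-- The inverse of `toSolidTorus`. -/
def fromSolidTorus (q : Circle × ℂ) : ℝ × ℂ :=
  (-(q.1 : ℂ).im / denom q, ((denom q)⁻¹ : ℝ) * q.2)

theorem re_sq_add_im_sq (c : Circle) : (c : ℂ).re ^ 2 + (c : ℂ).im ^ 2 = 1 := by
  have := Circle.normSq_coe c
  rw [Complex.normSq_apply] at this
  linarith

/-- The inequality `√(1 + ‖ζ‖²) ≥ 1 ≥ Re c` is an equality throughout only at `(1, 0)`, the point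
that stands for `∞`. -/
theorem denom_pos {q : Circle × ℂ} (hq : q ≠ (1, 0)) : 0 < denom q := by
  have h1 := re_sq_add_im_sq q.1
  have h2 : 1 ≤ √(1 + ‖q.2‖ ^ 2) := Real.one_le_sqrt.2 (by nlinarith [norm_nonneg q.2])
  have h3 : (q.1 : ℂ).re ≤ 1 := by nlinarith [sq_nonneg (q.1 : ℂ).im]
  refine sub_pos.2 (lt_of_le_of_ne (h3.trans h2) fun h => hq ?_)
  have h4 : (q.1 : ℂ).re = 1 := by linarith
  have h5 : (q.1 : ℂ).im = 0 := by nlinarith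
  have h6 : 1 + ‖q.2‖ ^ 2 = 1 := by
    rw [← Real.sqrt_eq_one, ← h, h4]
  refine Prod.ext (Circle.ext (Complex.ext h4 h5)) (norm_eq_zero.1 ?_)
  nlinarith

theorem winding_fromSolidTorus {q : Circle × ℂ} (hq : q ≠ (1, 0)) :
    winding (fromSolidTorus q) = ((2 / denom q : ℝ) : ℂ) * q.1 := by
  have hD := denom_pos hq
  have h1 := re_sq_add_im_sq q.1
  have h2 : √(1 + ‖q.2‖ ^ 2) ^ 2 = 1 + ‖q.2‖ ^ 2 := Real.sq_sqrt (by positivity)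
  -- Eliminating the root, with `D` the denominator, gives `‖ζ‖² + (Im c)² = D² + 2 D Re c`, hence
  -- real part `2 Re c / D`.
  have h3 : √(1 + ‖q.2‖ ^ 2) = denom q + (q.1 : ℂ).re := by simp [denom]
  rw [h3] at h2
  apply Complex.ext
  · rw [Complex.re_ofReal_mul]
    simp only [winding, fromSolidTorus, norm_mul, Complex.norm_real, Real.norm_eq_abs, mul_pow,
      sq_abs]
    field_simp
    linarith
  · rw [Complex.im_ofReal_mul]
    simp only [winding, fromSolidTorus]
    ring

theorem norm_winding_fromSolidTorus {q : Circle × ℂ} (hq : q ≠ (1, 0)) :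
    ‖winding (fromSolidTorus q)‖ = 2 / denom q := by
  have hD := denom_pos hq
  rw [winding_fromSolidTorus hq, norm_mul, Circle.norm_coe, mul_one, Complex.norm_real,
    Real.norm_of_nonneg (by positivity)]

theorem winding_fromSolidTorus_ne_zero {q : Circle × ℂ} (hq : q ≠ (1, 0)) :
    winding (fromSolidTorus q) ≠ 0 := by
  have hD := denom_pos hq
  rw [← norm_pos_iff, norm_winding_fromSolidTorus hq]
  positivity

theorem toSolidTorus_fromSolidTorus {q : Circle × ℂ} (hq : q ≠ (1, 0)) :
    toSolidTorus (fromSolidTorus q) = q := by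
  have hD := denom_pos hq
  have hD' : (denom q : ℂ) ≠ 0 := by exact_mod_cast hD.ne'
  refine Prod.ext (Circle.ext ?_) ?_
  · change (Circle.exp (winding (fromSolidTorus q)).arg : ℂ) = q.1
    rw [coe_exp_arg (winding_fromSolidTorus_ne_zero hq), norm_winding_fromSolidTorus hq,
      winding_fromSolidTorus hq, mul_div_cancel_left₀]
    exact_mod_cast (by positivity : 2 / denom q ≠ 0)
  · change ((2 / ‖winding (fromSolidTorus q)‖ : ℝ) : ℂ) * (((denom q)⁻¹ : ℝ) * q.2) = q.2
    rw [norm_winding_fromSolidTorus hq]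
    push_cast
    field_simp

/-- By `norm_winding_sq` the root is `(|p|² + 1) / ‖winding p‖`, while the real part is `(|p|² - 1)
/ ‖winding p‖`. -/
theorem denom_toSolidTorus {p : ℝ × ℂ} (hp : winding p ≠ 0) :
    denom (toSolidTorus p) = 2 / ‖winding p‖ := by
  have hw : 0 < ‖winding p‖ := norm_pos_iff.2 hp
  have h1 : 1 + ‖(toSolidTorus p).2‖ ^ 2 = ((p.1 ^ 2 + ‖p.2‖ ^ 2 + 1) / ‖winding p‖) ^ 2 := by
    have := norm_winding_sq p
    simp only [toSolidTorus, norm_mul, Complex.norm_real, Real.norm_eq_abs, mul_pow, sq_abs]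
    field_simp
    linarith
  have h2 : ((toSolidTorus p).1 : ℂ).re = (p.1 ^ 2 + ‖p.2‖ ^ 2 - 1) / ‖winding p‖ := by
    change (Circle.exp (winding p).arg : ℂ).re = _
    rw [coe_exp_arg hp, Complex.div_ofReal_re]
    rfl
  rw [denom, h1, Real.sqrt_sq (by positivity), h2]
  ring

theorem fromSolidTorus_toSolidTorus {p : ℝ × ℂ} (hp : winding p ≠ 0) :
    fromSolidTorus (toSolidTorus p) = p := by
  have hw : 0 < ‖winding p‖ := norm_pos_iff.2 hp
  have h2 : ((toSolidTorus p).1 : ℂ).im = (-2 * p.1) / ‖winding p‖ := by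
    change (Circle.exp (winding p).arg : ℂ).im = _
    rw [coe_exp_arg hp, Complex.div_ofReal_im]
    rfl
  refine Prod.ext ?_ ?_
  · simp only [fromSolidTorus, denom_toSolidTorus hp, h2]
    field_simp
  · have hw' : (‖winding p‖ : ℂ) ≠ 0 := by exact_mod_cast hw.ne'
    change (((denom (toSolidTorus p))⁻¹ : ℝ) : ℂ) * ((2 / ‖winding p‖ : ℝ) * p.2) = p.2
    rw [denom_toSolidTorus hp]
    push_cast
    field_simp

theorem toSolidTorus_ne {p : ℝ × ℂ} (hp : winding p ≠ 0) : toSolidTorus p ≠ (1, 0) := by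
  intro h
  have h1 := denom_toSolidTorus hp
  have : 0 < ‖winding p‖ := norm_pos_iff.2 hp
  rw [h] at h1
  have h2 : (0 : ℝ) = 2 / ‖winding p‖ := by simpa [denom] using h1
  have : 0 < 2 / ‖winding p‖ := by positivity
  linarith

theorem winding_ne_zero_of_notMem {p : ℝ × ℂ} (hp : p ∉ nbhdγ) : winding p ≠ 0 := by
  intro h
  exact hp (by simp [nbhdγ, h])

theorem notMem_nbhdγ_iff {p : ℝ × ℂ} (hp : winding p ≠ 0) :
    p ∉ nbhdγ ↔ ‖(toSolidTorus p).2‖ < 2 := by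
  have hw : 0 < ‖winding p‖ := norm_pos_iff.2 hp
  rw [nbhdγ, mem_ofPred_eq, not_le, toSolidTorus, norm_mul, Complex.norm_real,
    Real.norm_of_nonneg (by positivity), div_mul_eq_mul_div, div_lt_iff₀ hw]
  constructor <;> intro h <;> linarith

theorem toSolidTorus_snd_eq_zero_iff {p : ℝ × ℂ} (hp : winding p ≠ 0) :
    (toSolidTorus p).2 = 0 ↔ p.2 = 0 := by
  simp [toSolidTorus, hp]

/-- On `N(γ)` one gets `(|p|² + 1)² ≤ 5 ‖z‖² ≤ 5 |p|²`, which is impossible for `|p|² > 4`. -/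
theorem nbhdγ_subset_ball : nbhdγ ⊆ ball := by
  intro p hp
  have h1 := norm_winding_sq p
  have h2 : ‖winding p‖ ≤ ‖p.2‖ := hp
  have h3 : (p.1 ^ 2 + ‖p.2‖ ^ 2 + 1) ^ 2 ≤ 5 * ‖p.2‖ ^ 2 := by
    nlinarith [norm_nonneg (winding p)]
  rw [ball, mem_ofPred_eq]
  by_contra! h
  nlinarith [sq_nonneg p.1]

theorem isCompact_ball : IsCompact ball := by
  refine Metric.isCompact_of_isClosed_isBounded (isClosed_le (by fun_prop) continuous_const) ?_
  refine (Metric.isBounded_closedBall (x := (0 : ℝ × ℂ)) (r := 2)).subset fun p hp => ?_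
  have hp' : p.1 ^ 2 + ‖p.2‖ ^ 2 ≤ 4 := hp
  rw [mem_closedBall_zero_iff, Prod.norm_def, sup_le_iff, Real.norm_eq_abs, abs_le]
  exact ⟨⟨by nlinarith [sq_nonneg ‖p.2‖], by nlinarith [sq_nonneg ‖p.2‖]⟩,
    by nlinarith [norm_nonneg p.2, sq_nonneg p.1]⟩

theorem isCompact_nbhdγ : IsCompact nbhdγ :=
  isCompact_ball.of_isClosed_subset
    (isClosed_le contDiff_winding.continuous.norm continuous_snd.norm) nbhdγ_subset_ball

theorem contMDiffOn_toSolidTorus :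
    ContMDiffOn (𝓘(ℝ, ℝ).prod 𝓘(ℝ, ℂ)) ((𝓡 1).prod 𝓘(ℝ, ℂ)) ∞ toSolidTorus
      {p | winding p ≠ 0} := by
  intro p hp
  have h0 : ContMDiff (𝓘(ℝ, ℝ).prod 𝓘(ℝ, ℂ)) 𝓘(ℝ, ℝ × ℂ) ∞ (fun p : ℝ × ℂ => p) :=
    contMDiff_fst.prodMk_space contMDiff_snd
  have h1 : ContMDiffAt (𝓘(ℝ, ℝ).prod 𝓘(ℝ, ℂ)) 𝓘(ℝ, ℂ) ∞ winding p :=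
    contDiff_winding.contMDiff.comp h0 p
  refine ContMDiffAt.contMDiffWithinAt (ContMDiffAt.prodMk ?_ ?_)
  · exact (contMDiffAt_exp_arg hp).comp p h1
  · have h2 : ContDiffAt ℝ ∞ (fun p => ‖winding p‖) p := contDiff_winding.contDiffAt.norm ℝ hp
    have h3 : ContDiffAt ℝ ∞ (fun p => 2 / ‖winding p‖) p :=
      contDiffAt_const.div h2 (norm_ne_zero_iff.2 hp)
    have h4 : ContDiffAt ℝ ∞ (fun p => ((2 / ‖winding p‖ : ℝ) : ℂ) * p.2) p :=
      (Complex.ofRealCLM.contDiff.contDiffAt.comp p h3).mul contDiffAt_snd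
    exact h4.contMDiffAt.comp p (h0 p)

theorem contMDiff_denom : ContMDiff ((𝓡 1).prod 𝓘(ℝ, ℂ)) 𝓘(ℝ, ℝ) ∞ denom := by
  have h1 : ContMDiff ((𝓡 1).prod 𝓘(ℝ, ℂ)) 𝓘(ℝ, ℝ) ∞
      (fun q : Circle × ℂ => √(1 + ‖q.2‖ ^ 2)) := by
    have : ContDiff ℝ ∞ (fun z : ℂ => √(1 + ‖z‖ ^ 2)) :=
      (contDiff_const.add (contDiff_id.norm_sq ℝ)).sqrt fun z => by positivity
    exact this.contMDiff.comp contMDiff_snd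
  have h2 : ContMDiff ((𝓡 1).prod 𝓘(ℝ, ℂ)) 𝓘(ℝ, ℝ) ∞ (fun q : Circle × ℂ => (q.1 : ℂ).re) :=
    Complex.reCLM.contDiff.contMDiff.comp (contMDiff_circle_coe.comp contMDiff_fst)
  exact h1.sub h2

theorem contMDiffOn_fromSolidTorus :
    ContMDiffOn ((𝓡 1).prod 𝓘(ℝ, ℂ)) (𝓘(ℝ, ℝ).prod 𝓘(ℝ, ℂ)) ∞ fromSolidTorus {(1, 0)}ᶜ := by
  intro q hq
  have hD := denom_pos hq
  have h1 : ContMDiffAt ((𝓡 1).prod 𝓘(ℝ, ℂ)) 𝓘(ℝ, ℝ) ∞ (fun q => (denom q)⁻¹) q :=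
    (contDiffAt_inv ℝ hD.ne').contMDiffAt.comp q contMDiff_denom.contMDiffAt
  refine ContMDiffAt.contMDiffWithinAt (ContMDiffAt.prodMk ?_ ?_)
  · have h2 : ContMDiff ((𝓡 1).prod 𝓘(ℝ, ℂ)) 𝓘(ℝ, ℝ) ∞ (fun q : Circle × ℂ => -(q.1 : ℂ).im) :=
      (Complex.imCLM.contDiff.neg).contMDiff.comp (contMDiff_circle_coe.comp contMDiff_fst)
    exact h2.contMDiffAt.smul h1
  · simp only [← Complex.real_smul]
    exact h1.smul contMDiff_snd.contMDiffAt

/-- The diffeomorphism between the complement of `γ` and the solid torus minus a point. -/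
def solidTorus :
    PartialDiffeomorph (𝓘(ℝ, ℝ).prod 𝓘(ℝ, ℂ)) ((𝓡 1).prod 𝓘(ℝ, ℂ)) (ℝ × ℂ) (Circle × ℂ) ∞ where
  toFun := toSolidTorus
  invFun := fromSolidTorus
  source := {p | winding p ≠ 0}
  target := {(1, 0)}ᶜ
  map_source' _ hp := toSolidTorus_ne hp
  map_target' _ hq := winding_fromSolidTorus_ne_zero hq
  left_inv' _ hp := fromSolidTorus_toSolidTorus hp
  right_inv' _ hq := toSolidTorus_fromSolidTorus hq
  open_source := isOpen_ne_fun contDiff_winding.continuous continuous_const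
  open_target := isOpen_compl_singleton
  contMDiffOn_toFun := contMDiffOn_toSolidTorus
  contMDiffOn_invFun := contMDiffOn_fromSolidTorus

theorem isLocalDiffeomorphAt_fromSolidTorus {q : Circle × ℂ} (hq : q ≠ (1, 0)) :
    IsLocalDiffeomorphAt ((𝓡 1).prod 𝓘(ℝ, ℂ)) (𝓘(ℝ, ℝ).prod 𝓘(ℝ, ℂ)) ∞ fromSolidTorus q :=
  solidTorus.symm.isLocalDiffeomorphAt _ _ _ hq

theorem fromSolidTorus_injOn : InjOn fromSolidTorus {(1, 0)}ᶜ := solidTorus.symm.injOn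

end TwistRim

/-- A span of injective local diffeomorphisms defines a partial diffeomorphism. -/
theorem exists_partialDiffeomorph_of_span {E₁ E₂ E₃ : Type*} [NormedAddCommGroup E₁]
    [NormedSpace ℝ E₁] [NormedAddCommGroup E₂] [NormedSpace ℝ E₂] [NormedAddCommGroup E₃]
    [NormedSpace ℝ E₃] {H₁ H₂ H₃ : Type*} [TopologicalSpace H₁] [TopologicalSpace H₂]
    [TopologicalSpace H₃] {I₁ : ModelWithCorners ℝ E₁ H₁} {I₂ : ModelWithCorners ℝ E₂ H₂}
    {I₃ : ModelWithCorners ℝ E₃ H₃} {A B C : Type*} [TopologicalSpace A] [ChartedSpace H₁ A]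
    [TopologicalSpace B] [ChartedSpace H₂ B] [TopologicalSpace C] [ChartedSpace H₃ C]
    [Nonempty C] {n : WithTop ℕ∞} {D : Set C} (hD : IsOpen D) {a : C → A} {b : C → B}
    (ha : IsLocalDiffeomorphOn I₃ I₁ n a D) (hb : IsLocalDiffeomorphOn I₃ I₂ n b D)
    (hia : InjOn a D) (hib : InjOn b D) :
    ∃ T : PartialDiffeomorph I₁ I₂ A B n,
      ∀ x y, x ∈ T.source ∧ T x = y ↔ ∃ c ∈ D, a c = x ∧ b c = y := by
  let Φ := ha.toPartialDiffeomorph hD hia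
  let Ψ := hb.toPartialDiffeomorph hD hib
  have hΦ : ∀ c ∈ D, Φ.symm (a c) = c := fun c hc => Φ.left_inv hc
  refine ⟨Φ.symm.trans Ψ, fun x y => ⟨?_, ?_⟩⟩
  · rintro ⟨⟨⟨c, hc, rfl⟩, -⟩, h⟩
    refine ⟨c, hc, rfl, ?_⟩
    change b (Φ.symm (a c)) = y at h
    rwa [hΦ c hc] at h
  · rintro ⟨c, hc, rfl, rfl⟩
    refine ⟨⟨⟨c, hc, rfl⟩, ?_⟩, congrArg b (hΦ c hc)⟩
    change Φ.symm (a c) ∈ D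
    rwa [hΦ c hc]

theorem ContMDiffAt.of_comp_isLocalDiffeomorphAt {E₁ E₂ E₃ : Type*} [NormedAddCommGroup E₁]
    [NormedSpace ℝ E₁] [NormedAddCommGroup E₂] [NormedSpace ℝ E₂] [NormedAddCommGroup E₃]
    [NormedSpace ℝ E₃] {H₁ H₂ H₃ : Type*} [TopologicalSpace H₁] [TopologicalSpace H₂]
    [TopologicalSpace H₃] {I₁ : ModelWithCorners ℝ E₁ H₁} {I₂ : ModelWithCorners ℝ E₂ H₂}
    {I₃ : ModelWithCorners ℝ E₃ H₃} {A B C : Type*} [TopologicalSpace A] [ChartedSpace H₁ A]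
    [TopologicalSpace B] [ChartedSpace H₂ B] [TopologicalSpace C] [ChartedSpace H₃ C]
    {n : WithTop ℕ∞} {f : B → C} {h : A → B} {x : A} (hfh : ContMDiffAt I₁ I₃ n (f ∘ h) x)
    (hh : IsLocalDiffeomorphAt I₁ I₂ n h x) : ContMDiffAt I₂ I₃ n f (h x) := by
  have hx : hh.localInverse (h x) = x := hh.localInverse_left_inv hh.localInverse_mem_target
  have h2 : ContMDiffAt I₁ I₃ n (f ∘ h) (hh.localInverse (h x)) := by rwa [hx]
  refine (h2.comp _ hh.localInverse_contMDiffAt).congr_of_eventuallyEq ?_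
  filter_upwards [hh.localInverse_eventuallyEq_right] with y hy
  exact (congrArg f hy).symm

/-! ### Charts, and the flow interpolating the powers of the twist. -/

namespace TwistRim

/-- Charts of a manifold without boundary with values in a vector space. -/
theorem exists_chart {E F H X : Type*} [NormedAddCommGroup E] [NormedSpace ℝ E]
    [NormedAddCommGroup F] [NormedSpace ℝ F] [TopologicalSpace H] (I : ModelWithCorners ℝ E H)
    [I.Boundaryless] [TopologicalSpace X] [ChartedSpace H X] [IsManifold I ∞ X] (L : E ≃L[ℝ] F)
    (x : X) : ∃ c : PartialDiffeomorph I 𝓘(ℝ, F) X F ∞, x ∈ c.source := by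
  let Λ : Diffeomorph I 𝓘(ℝ, F) H F ∞ :=
    { toFun := fun p => L (I p)
      invFun := fun z => I.symm (L.symm z)
      left_inv := fun p => by simp
      right_inv := fun z => by
        simp only
        rw [I.right_inv (by simp [I.range_eq_univ]), L.apply_symm_apply]
      contMDiff_toFun := L.contDiff.contMDiff.comp I.contMDiff
      contMDiff_invFun := by
        have h : ContMDiffOn 𝓘(ℝ, E) I ∞ I.symm (range I) := I.contMDiffOn_symm
        rw [I.range_eq_univ, contMDiffOn_univ] at h
        exact h.comp L.symm.contDiff.contMDiff }
  let c : PartialDiffeomorph I I X H ∞ :=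
    { __ := chartAt H x
      contMDiffOn_toFun := contMDiffOn_chart
      contMDiffOn_invFun := contMDiffOn_chart_symm }
  exact ⟨c.trans Λ.toPartialDiffeomorph, mem_chart_source _ x, mem_univ _⟩

theorem cover_zpow (s : ℝ) (m : ℤ) : cover s ^ m = cover (m * s) := by
  induction m using Int.induction_on with
  | zero => simp [cover]
  | succ k ih => rw [zpow_add_one, ih, ← cover_add]; push_cast; ring_nf
  | pred k ih =>
    rw [zpow_sub_one, ih, mul_inv_eq_iff_eq_mul, ← cover_add]; push_cast; ring_nf

namespace KnotTube

variable {K : Set S3} (ν : KnotTube K)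

theorem angle_of_le {ζ : ℂ} (h : ‖ζ‖ ≤ 2) : angle ζ = 0 := by
  rw [angle, Real.smoothTransition.zero_of_nonpos (by linarith), mul_zero]

theorem angle_of_ge {ζ : ℂ} (h : 3 ≤ ‖ζ‖) : angle ζ = 2 * Real.pi := by
  rw [angle, Real.smoothTransition.one_of_one_le (by linarith), mul_one]

theorem angle_circle_mul (c : Circle) (ζ : ℂ) : angle (c * ζ) = angle ζ := by
  rw [angle, norm_mul, Circle.norm_coe, one_mul, angle]

/-- The norm is not smooth at `0`, but the angle vanishes identically near `0`. -/
theorem contDiff_angle : ContDiff ℝ ∞ angle := by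
  rw [contDiff_iff_contDiffAt]
  intro ζ
  by_cases h : ζ = 0
  · subst h
    refine (contDiffAt_const (c := (0 : ℝ))).congr_of_eventuallyEq ?_
    filter_upwards [Metric.ball_mem_nhds (0 : ℂ) two_pos] with z hz
    exact angle_of_le (by simpa using (mem_ball_zero_iff.1 hz).le)
  · have h1 : ContDiffAt ℝ ∞ (fun z : ℂ => ‖z‖ - 2) ζ :=
      (contDiffAt_id.norm ℝ h).sub contDiffAt_const
    exact contDiffAt_const.mul (Real.smoothTransition.contDiff.contDiffAt.comp ζ h1)

open Classical in
/-- The flow on `(S³, K)` that rotates the normal discs of the tube, and whose time one map is the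
twist. -/
def flow (t : ℝ) (q : S3) : S3 :=
  if h : ∃ p : Circle × ℂ, ν.toFun p = q then
    ν.toFun (h.choose.1, Circle.exp (t * (angle h.choose.2 - 2 * Real.pi)) * h.choose.2)
  else q

theorem flow_tube (t : ℝ) (c : Circle) (ζ : ℂ) :
    ν.flow t (ν.toFun (c, ζ)) =
      ν.toFun (c, Circle.exp (t * (angle ζ - 2 * Real.pi)) * ζ) := by
  have h : ∃ p : Circle × ℂ, ν.toFun p = ν.toFun (c, ζ) := ⟨_, rfl⟩
  have h2 : h.choose = (c, ζ) := ν.injective h.choose_spec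
  rw [flow, dif_pos h, h2]

theorem flow_of_notMem_range (t : ℝ) {q : S3} (hq : q ∉ range ν.toFun) : ν.flow t q = q :=
  dif_neg hq

/-- Rotations preserve `‖ζ‖`, so the angular speed is constant along orbits. -/
theorem flow_flow (s t : ℝ) (q : S3) : ν.flow s (ν.flow t q) = ν.flow (s + t) q := by
  by_cases h : q ∈ range ν.toFun
  · obtain ⟨⟨c, ζ⟩, rfl⟩ := h
    rw [flow_tube, flow_tube, flow_tube, angle_circle_mul, ← mul_assoc, ← Circle.coe_mul,
      ← Circle.exp_add, ← add_mul]
  · rw [ν.flow_of_notMem_range t h, ν.flow_of_notMem_range s h, ν.flow_of_notMem_range _ h]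

theorem flow_zero (q : S3) : ν.flow 0 q = q := by
  by_cases h : q ∈ range ν.toFun
  · obtain ⟨⟨c, ζ⟩, rfl⟩ := h
    simp [flow_tube]
  · exact ν.flow_of_notMem_range 0 h

theorem flow_eq_iff {t : ℝ} {q q' : S3} : ν.flow t q = q' ↔ q = ν.flow (-t) q' := by
  constructor
  · rintro rfl
    rw [flow_flow, neg_add_cancel, flow_zero]
  · rintro rfl
    rw [flow_flow, add_neg_cancel, flow_zero]

/-- The shift by `-2π` is invisible at time one; at other times it is what keeps the flow stationary
for `‖ζ‖ ≥ 3`, and hence continuous across the end of the tube. -/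
theorem flow_one (q : S3) : ν.flow 1 q = ν.twist q := by
  change _ = ν.rotate 1 q
  by_cases h : q ∈ range ν.toFun
  · obtain ⟨⟨c, ζ⟩, rfl⟩ := h
    rw [flow_tube, rotate_tube, one_mul, one_mul, Circle.exp_sub, Circle.exp_two_pi, div_one]
  · rw [ν.flow_of_notMem_range 1 h]
    have h' : ¬ ∃ p, ν.toFun p = q := h
    rw [rotate, dif_neg h']

theorem twist_zpow (k : ℤ) (q : S3) : (ν.twist ^ k) q = ν.flow k q := by
  induction k using Int.induction_on generalizing q with
  | zero => simp [flow_zero]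
  | succ k ih =>
    rw [zpow_add_one, Equiv.Perm.mul_apply, ih, ← flow_one, flow_flow]
    push_cast
    rfl
  | pred k ih =>
    have h1 : ν.twist⁻¹ q = ν.flow (-1) q := by
      rw [Equiv.Perm.inv_eq_iff_eq, ← flow_one, flow_flow]
      norm_num [flow_zero]
    rw [zpow_sub_one, Equiv.Perm.mul_apply, ih, h1, flow_flow]
    push_cast
    rfl

theorem flow_core (t : ℝ) (c : Circle) : ν.flow t (ν.toFun (c, 0)) = ν.toFun (c, 0) := by
  rw [flow_tube, mul_zero]

theorem core_mem (c : Circle) : ν.toFun (c, 0) ∈ K :=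
  ν.core.subset ⟨c, rfl⟩

theorem exists_of_mem {q : S3} (hq : q ∈ K) : ∃ c : Circle, ν.toFun (c, 0) = q := by
  rwa [← ν.core] at hq

theorem toFun_mem_iff {x : Circle × ℂ} : ν.toFun x ∈ K ↔ x.2 = 0 := by
  constructor
  · intro h
    by_contra h'
    exact ν.mem_compl x.1 h' h
  · intro h
    rw [show x = (x.1, 0) from Prod.ext rfl h]
    exact ν.core_mem _

theorem flow_mem_iff (t : ℝ) {q : S3} : ν.flow t q ∈ K ↔ q ∈ K := by
  have key : ∀ (t : ℝ) (q : S3), q ∈ K → ν.flow t q ∈ K := by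
    intro t q hq
    obtain ⟨c, rfl⟩ := ν.exists_of_mem hq
    rwa [flow_core]
  refine ⟨fun h => ?_, key t q⟩
  rw [(ν.flow_eq_iff (t := t) (q := q)).1 rfl]
  exact key _ _ h

/-- Inside the compact tube, the flow is a rotation with constant speed. -/
theorem flow_tube_of_norm_le (m : ℤ) (s : ℝ) (c : Circle) {ζ : ℂ} (h : ‖ζ‖ ≤ 2) :
    ν.flow (-(m * s)) (ν.toFun (c, ζ)) = ν.toFun (c, ((cover s ^ m : Circle) : ℂ) * ζ) := by
  rw [flow_tube, angle_of_le h, cover_zpow, cover]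
  ring_nf

theorem continuous : Continuous ν.toFun := ν.localDiffeo.contMDiff.continuous

theorem isClosed_knot (ν : KnotTube K) : IsClosed K := by
  rw [← ν.core]
  exact (isCompact_range (ν.continuous.comp (by fun_prop))).isClosed

theorem contMDiff_flow (a : ℝ) :
    ContMDiff ((𝓡 3).prod 𝓘(ℝ, ℝ)) (𝓡 3) ∞ (fun b : S3 × ℝ => ν.flow (a * b.2) b.1) := by
  rintro ⟨q, s⟩
  by_cases h : q ∈ range ν.toFun
  · obtain ⟨x, rfl⟩ := h
    have hl : IsLocalDiffeomorphAt (((𝓡 1).prod 𝓘(ℝ, ℂ)).prod 𝓘(ℝ, ℝ)) ((𝓡 3).prod 𝓘(ℝ, ℝ)) ∞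
        (Prod.map ν.toFun (fun t : ℝ => t)) (x, s) :=
      (ν.localDiffeo x).prodMap (IsLocalDiffeomorphAt.id s)
    refine ContMDiffAt.of_comp_isLocalDiffeomorphAt (h := Prod.map ν.toFun (fun t : ℝ => t))
      (x := (x, s)) ?_ hl
    have h1 : ContMDiff (((𝓡 1).prod 𝓘(ℝ, ℂ)).prod 𝓘(ℝ, ℝ)) 𝓘(ℝ, ℂ) ∞
        (fun y : (Circle × ℂ) × ℝ => y.1.2) := contMDiff_snd.comp contMDiff_fst
    have h2 : ContMDiff (((𝓡 1).prod 𝓘(ℝ, ℂ)).prod 𝓘(ℝ, ℝ)) 𝓘(ℝ, ℝ) ∞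
        (fun y : (Circle × ℂ) × ℝ => a * y.2 * (angle y.1.2 - 2 * Real.pi)) := by
      refine (contMDiff_const.mul contMDiff_snd).mul (ContMDiff.sub ?_ contMDiff_const)
      exact contDiff_angle.contMDiff.comp h1
    have h3 : ContMDiff (((𝓡 1).prod 𝓘(ℝ, ℂ)).prod 𝓘(ℝ, ℝ)) 𝓘(ℝ, ℂ) ∞
        (fun y : (Circle × ℂ) × ℝ =>
          (Circle.exp (a * y.2 * (angle y.1.2 - 2 * Real.pi)) : ℂ) * y.1.2) := by
      have h4 := contMDiff_circle_coe.comp ((contMDiff_circleExp (m := ∞)).comp h2)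
      have h5 : ContDiff ℝ ∞ (fun z : ℂ × ℂ => z.1 * z.2) := contDiff_mul
      exact h5.contMDiff.comp (h4.prodMk_space h1)
    have h6 := ν.localDiffeo.contMDiff.comp ((contMDiff_fst.comp contMDiff_fst).prodMk h3)
    refine (h6 (x, s)).congr_of_eventuallyEq (Eventually.of_forall fun y => ?_)
    exact ν.flow_tube _ _ _
  -- A point off the tube has a neighbourhood missing the compact part `‖ζ‖ ≤ 3`, and there the flow
  -- is the identity.
  · have hcl : IsClosed (ν.toFun '' (univ ×ˢ Metric.closedBall (0 : ℂ) 3)) :=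
      ((isCompact_univ.prod (isCompact_closedBall _ _)).image ν.continuous).isClosed
    have hq : q ∉ ν.toFun '' (univ ×ˢ Metric.closedBall (0 : ℂ) 3) :=
      fun hq => h (image_subset_range _ _ hq)
    refine contMDiffAt_fst.congr_of_eventuallyEq ?_
    have hev : ∀ᶠ b : S3 × ℝ in 𝓝 (q, s), b.1 ∉ ν.toFun '' (univ ×ˢ Metric.closedBall (0 : ℂ) 3) :=
      (hcl.isOpen_compl.preimage continuous_fst).mem_nhds hq
    filter_upwards [hev] with b hb
    by_cases hb' : b.1 ∈ range ν.toFun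
    · obtain ⟨⟨c, ζ⟩, hc⟩ := hb'
      have h3 : 3 ≤ ‖ζ‖ := by
        by_contra! h3
        exact hb ⟨(c, ζ), ⟨mem_univ _, mem_closedBall_zero_iff.2 h3.le⟩, hc⟩
      rw [← hc, flow_tube, angle_of_ge h3]
      simp
    · exact ν.flow_of_notMem_range _ hb'

/-- The diffeomorphism of `S³ × ℝ` defined by the flow. -/
def flowDiffeo (a : ℝ) :
    Diffeomorph ((𝓡 3).prod 𝓘(ℝ, ℝ)) ((𝓡 3).prod 𝓘(ℝ, ℝ)) (S3 × ℝ) (S3 × ℝ) ∞ where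
  toFun b := (ν.flow (a * b.2) b.1, b.2)
  invFun b := (ν.flow (-a * b.2) b.1, b.2)
  left_inv b := by
    ext1
    · change ν.flow _ (ν.flow _ _) = _
      rw [flow_flow, neg_mul, neg_add_cancel, flow_zero]
    · rfl
  right_inv b := by
    ext1
    · change ν.flow _ (ν.flow _ _) = _
      rw [flow_flow, neg_mul, add_neg_cancel, flow_zero]
    · rfl
  contMDiff_toFun := (ν.contMDiff_flow a).prodMk contMDiff_snd
  contMDiff_invFun := (ν.contMDiff_flow (-a)).prodMk contMDiff_snd

end KnotTube

end TwistRim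

/-! ### Existence of the rim torus surgery. -/

namespace TwistRim

variable {P : SurfacePair.{u}} {α : Circle → P.carrier} {K : Set S3}

/-- The complement of the rim torus in the tubular neighbourhood of `α`, in the coordinates of the
solid torus. -/
def CurveTrivialization.solid (σ : CurveTrivialization P α) (y : Circle × (Circle × ℂ)) :
    P.carrier :=
  σ.toFun (y.1, fromSolidTorus y.2)

/-- The product of the tube of the knot with a circle, with the normal discs of the tube rotated
`m` times along the circle. -/
def KnotTube.twisted (ν : KnotTube K) (m : ℤ) (y : Circle × (Circle × ℂ)) : S3 × Circle :=
  (ν.toFun (y.2.1, ((y.1 ^ m : Circle) : ℂ) * y.2.2), y.1)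

/-- The collar along which the two pieces of the rim torus surgery are glued. -/
def collar : Set (Circle × (Circle × ℂ)) := {y | y.2.2 ≠ 0 ∧ ‖y.2.2‖ < 2}

theorem ne_of_mem_collar {y : Circle × (Circle × ℂ)} (hy : y ∈ collar) : y.2 ≠ (1, 0) :=
  fun h => hy.1 (congrArg Prod.snd h)

theorem isOpen_collar : IsOpen collar :=
  (isOpen_ne_fun (continuous_snd.comp continuous_snd) continuous_const).inter
    (isOpen_lt (continuous_snd.comp continuous_snd).norm continuous_const)

theorem fromSolidTorus_notMem_nbhdγ_iff {q : Circle × ℂ} (hq : q ≠ (1, 0)) :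
    fromSolidTorus q ∉ nbhdγ ↔ ‖q.2‖ < 2 := by
  rw [notMem_nbhdγ_iff (winding_fromSolidTorus_ne_zero hq), toSolidTorus_fromSolidTorus hq]

theorem fromSolidTorus_snd_eq_zero_iff {q : Circle × ℂ} (hq : q ≠ (1, 0)) :
    (fromSolidTorus q).2 = 0 ↔ q.2 = 0 := by
  rw [← toSolidTorus_snd_eq_zero_iff (winding_fromSolidTorus_ne_zero hq),
    toSolidTorus_fromSolidTorus hq]

namespace CurveTrivialization

variable (σ : CurveTrivialization P α)

theorem mem_image_iff {s : Set (ℝ × ℂ)} {θ : Circle} {p : ℝ × ℂ} :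
    σ.toFun (θ, p) ∈ σ.toFun '' (univ ×ˢ s) ↔ p ∈ s := by
  rw [σ.injective.mem_set_image]
  simp

theorem isOpen_compl_image {s : Set (ℝ × ℂ)} (hs : IsCompact s) :
    IsOpen (σ.toFun '' (univ ×ˢ s))ᶜ :=
  ((isCompact_univ.prod hs).image σ.localDiffeo.contMDiff.continuous).isClosed.isOpen_compl

theorem solid_injOn : InjOn σ.solid {y | y.2 ≠ (1, 0)} := by
  intro y hy y' hy' h
  have h1 := Prod.ext_iff.1 (σ.injective h)
  exact Prod.ext h1.1 (fromSolidTorus_injOn hy hy' h1.2)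

theorem isLocalDiffeomorphAt_solid {y : Circle × (Circle × ℂ)} (hy : y.2 ≠ (1, 0)) :
    IsLocalDiffeomorphAt ((𝓡 1).prod ((𝓡 1).prod 𝓘(ℝ, ℂ))) (𝓡 4) ∞ σ.solid y :=
  ((IsLocalDiffeomorphAt.id y.1).prodMap (isLocalDiffeomorphAt_fromSolidTorus hy)).comp _ _
    (σ.localDiffeo _)

theorem solid_mem_surface_iff {y : Circle × (Circle × ℂ)} (hy : y.2 ≠ (1, 0)) :
    σ.solid y ∈ P.surface ↔ y.2.2 = 0 := by
  rw [← fromSolidTorus_snd_eq_zero_iff hy]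
  exact σ.mem_surface_iff _ _ _

theorem solid_mem_compl_iff {y : Circle × (Circle × ℂ)} (hy : y.2 ≠ (1, 0)) :
    σ.solid y ∈ (σ.toFun '' (univ ×ˢ nbhdγ))ᶜ ↔ ‖y.2.2‖ < 2 := by
  rw [mem_compl_iff, solid, σ.mem_image_iff, fromSolidTorus_notMem_nbhdγ_iff hy]

theorem exists_solid_eq {θ : Circle} {p : ℝ × ℂ} (hp : winding p ≠ 0) :
    σ.toFun (θ, p) = σ.solid (θ, toSolidTorus p) := by
  rw [solid, fromSolidTorus_toSolidTorus hp]

end CurveTrivialization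

namespace KnotTube

variable (ν : KnotTube K) (m : ℤ)

theorem contMDiff_circle_zpow : ContMDiff (𝓡 1) (𝓡 1) ∞ (fun c : Circle => c ^ m) := by
  cases m with
  | ofNat k => simpa using contMDiff_pow (I := 𝓡 1) (G := Circle) k
  | negSucc k =>
    simp only [zpow_negSucc]
    exact (contMDiff_pow (I := 𝓡 1) (G := Circle) (k + 1)).inv

/-- The diffeomorphism that rotates the discs of a solid torus along a circle. -/
def shear : Diffeomorph ((𝓡 1).prod ((𝓡 1).prod 𝓘(ℝ, ℂ))) (((𝓡 1).prod 𝓘(ℝ, ℂ)).prod (𝓡 1))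
    (Circle × (Circle × ℂ)) ((Circle × ℂ) × Circle) ∞ where
  toFun y := ((y.2.1, ((y.1 ^ m : Circle) : ℂ) * y.2.2), y.1)
  invFun y := (y.2, (y.1.1, ((y.2 ^ (-m) : Circle) : ℂ) * y.1.2))
  left_inv y := by
    have h : ((y.1 : ℂ) ^ m) ≠ 0 := zpow_ne_zero m (Circle.coe_ne_zero _)
    refine Prod.ext rfl (Prod.ext rfl ?_)
    simp [h]
  right_inv y := by
    have h : ((y.2 : ℂ) ^ m) ≠ 0 := zpow_ne_zero m (Circle.coe_ne_zero _)
    refine Prod.ext (Prod.ext rfl ?_) rfl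
    simp [h]
  contMDiff_toFun := by
    have h5 : ContDiff ℝ ∞ (fun z : ℂ × ℂ => z.1 * z.2) := contDiff_mul
    have h1 : ContMDiff (𝓡 1) (𝓡 1) ∞ (fun c : Circle => c ^ m) := contMDiff_circle_zpow m
    exact ((contMDiff_fst.comp contMDiff_snd).prodMk (h5.contMDiff.comp
      ((contMDiff_circle_coe.comp (h1.comp contMDiff_fst)).prodMk_space
        (contMDiff_snd.comp contMDiff_snd)))).prodMk contMDiff_fst
  contMDiff_invFun := by
    have h5 : ContDiff ℝ ∞ (fun z : ℂ × ℂ => z.1 * z.2) := contDiff_mul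
    have h1 : ContMDiff (𝓡 1) (𝓡 1) ∞ (fun c : Circle => c ^ (-m)) := contMDiff_circle_zpow _
    exact contMDiff_snd.prodMk ((contMDiff_fst.comp contMDiff_fst).prodMk (h5.contMDiff.comp
      ((contMDiff_circle_coe.comp (h1.comp contMDiff_snd)).prodMk_space
        (contMDiff_snd.comp contMDiff_fst))))

theorem isLocalDiffeomorphAt_twisted (y : Circle × (Circle × ℂ)) :
    IsLocalDiffeomorphAt ((𝓡 1).prod ((𝓡 1).prod 𝓘(ℝ, ℂ))) ((𝓡 3).prod (𝓡 1)) ∞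
      (ν.twisted m) y :=
  ((shear m).isLocalDiffeomorph y).comp _ _
    ((ν.localDiffeo _).prodMap (IsLocalDiffeomorphAt.id _))

theorem twisted_injective : Function.Injective (ν.twisted m) := by
  intro y y' h
  have h1 := Prod.ext_iff.1 h
  exact (shear m).injective (Prod.ext (ν.injective h1.1) h1.2)

theorem continuous_twisted : Continuous (ν.twisted m) :=
  continuous_iff_continuousAt.2 fun y => (ν.isLocalDiffeomorphAt_twisted m y).continuousAt

theorem twisted_mem_iff {y : Circle × (Circle × ℂ)} : (ν.twisted m y).1 ∈ K ↔ y.2.2 = 0 := by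
  rw [twisted, toFun_mem_iff, mul_eq_zero]
  exact or_iff_right (Circle.coe_ne_zero _)

end KnotTube

variable (σ : CurveTrivialization P α) (ν : KnotTube K) (m : ℤ)

/-- Substituting `toSolidTorus p` for `p` presents the gluing relation as a span of two embeddings
of the collar. -/
theorem rim_gluing_iff (x : P.carrier) (b : S3 × Circle) :
    (∃ p : ℝ × ℂ, p.2 ≠ 0 ∧ p ∉ nbhdγ ∧ x = σ.toFun (b.2, p) ∧
      b.1 = ν.toFun ((toSolidTorus p).1, ((b.2 ^ m : Circle) : ℂ) * (toSolidTorus p).2)) ↔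
    ∃ y ∈ collar, σ.solid y = x ∧ ν.twisted m y = b := by
  constructor
  · rintro ⟨p, hp, hpγ, rfl, hb⟩
    have hw := winding_ne_zero_of_notMem hpγ
    refine ⟨(b.2, toSolidTorus p), ⟨?_, (notMem_nbhdγ_iff hw).1 hpγ⟩, (σ.exists_solid_eq hw).symm,
      Prod.ext hb.symm rfl⟩
    rwa [Ne, toSolidTorus_snd_eq_zero_iff hw]
  · rintro ⟨y, hy, rfl, rfl⟩
    have hy' := ne_of_mem_collar hy
    refine ⟨fromSolidTorus y.2, ?_, (fromSolidTorus_notMem_nbhdγ_iff hy').2 hy.2, rfl, ?_⟩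
    · rw [Ne, fromSolidTorus_snd_eq_zero_iff hy']
      exact hy.1
    · rw [toSolidTorus_fromSolidTorus hy']
      rfl

/-- The graph can only fail to be closed at the two ends of the collar. The end `‖ζ‖ = 0` is
excluded by `b ∉ K`, the end `‖ζ‖ = 2` by `x ∉ N(T)`. -/
theorem mem_of_mem_closure_gluing {x : P.carrier} {b : S3 × Circle}
    (hx : x ∈ (σ.toFun '' (univ ×ˢ nbhdγ))ᶜ) (hb : b.1 ∉ K)
    (h : (x, b) ∈ closure {p : P.carrier × (S3 × Circle) |
      ∃ y ∈ collar, σ.solid y = p.1 ∧ ν.twisted m y = p.2}) :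
    ∃ y ∈ collar, σ.solid y = x ∧ ν.twisted m y = b := by
  obtain ⟨u, hu, hlim⟩ := mem_closure_iff_seq_limit.1 h
  choose y hy hyσ hyν using hu
  have hcpt : IsCompact ((univ : Set Circle) ×ˢ ((univ : Set Circle) ×ˢ Metric.closedBall (0 : ℂ) 2)) :=
    isCompact_univ.prod (isCompact_univ.prod (isCompact_closedBall _ _))
  -- The closure of the collar is compact, so collar points representing a convergent sequence of
  -- the graph subconverge.
  obtain ⟨z, -, φ, hφ, hz⟩ := hcpt.tendsto_subseq (x := y)
    fun n => ⟨mem_univ _, mem_univ _, mem_closedBall_zero_iff.2 (hy n).2.le⟩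
  have hlim' := hlim.comp hφ.tendsto_atTop
  have h2 : Tendsto (fun n => ν.twisted m (y (φ n))) atTop (𝓝 b) := by
    simp only [hyν]
    exact (continuous_snd.tendsto _).comp hlim'
  have hzb : ν.twisted m z = b :=
    tendsto_nhds_unique (((ν.continuous_twisted m).tendsto z).comp hz) h2
  have hz0 : z.2.2 ≠ 0 := by
    rwa [← hzb, ν.twisted_mem_iff] at hb
  have hz1 : z.2 ≠ (1, 0) := fun h => hz0 (congrArg Prod.snd h)
  have h3 : Tendsto (fun n => σ.solid (y (φ n))) atTop (𝓝 x) := by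
    simp only [hyσ]
    exact (continuous_fst.tendsto _).comp hlim'
  have hzx : σ.solid z = x :=
    tendsto_nhds_unique ((σ.isLocalDiffeomorphAt_solid hz1).continuousAt.tendsto.comp hz) h3
  refine ⟨z, ⟨hz0, ?_⟩, hzx, hzb⟩
  rwa [← hzx, σ.solid_mem_compl_iff hz1] at hx

theorem exists_isRimTorusSurgery : ∃ Q : SurfacePair.{u}, IsRimTorusSurgery σ ν m Q := by
  have : Nonempty P.carrier := ⟨σ.toFun (1, 0, 0)⟩
  have : Nonempty (S3 × Circle) := ⟨(ν.point, 1)⟩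
  obtain ⟨T, hT⟩ := exists_partialDiffeomorph_of_span isOpen_collar
    (fun y => σ.isLocalDiffeomorphAt_solid (ne_of_mem_collar y.2))
    (fun y => ν.isLocalDiffeomorphAt_twisted m y)
    (σ.solid_injOn.mono fun _ => ne_of_mem_collar) (ν.twisted_injective m).injOn
  have hU := σ.isOpen_compl_image isCompact_nbhdγ
  have hV : IsOpen {b : S3 × Circle | b.1 ∉ K} := ν.isClosed_knot.isOpen_compl.preimage continuous_fst
  obtain ⟨Q, i, j, hg⟩ := GluingMaps.exists_of_partialDiffeomorph T hU hV
    (by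
      intro x hx
      obtain ⟨y, hy, rfl, -⟩ := (hT x _).1 ⟨hx, rfl⟩
      exact (σ.solid_mem_compl_iff (ne_of_mem_collar hy)).2 hy.2)
    (by
      intro b hb
      obtain ⟨y, hy, -, hyb⟩ := (hT _ b).1 ⟨T.map_target hb, T.right_inv hb⟩
      rw [← hyb, mem_ofPred_eq, ν.twisted_mem_iff]
      exact hy.1)
    -- At the centre of the ball `winding` is `-1` and the second coordinate is `0`, so this point
    -- lies outside `N(γ)`.
    ⟨σ.toFun (1, 0, 0), fun h => by
      rw [σ.mem_image_iff] at h
      simp [nbhdγ, winding, Complex.ext_iff] at h⟩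
  obtain ⟨_, _, _, _, _, hi, hj⟩ := hg.exists_isManifold (I := 𝓡 4)
    (exists_chart (𝓡 4) (ContinuousLinearEquiv.refl ℝ _))
    (exists_chart ((𝓡 3).prod (𝓡 1)) (ContinuousLinearEquiv.ofFinrankEq (by simp)))
    (by
      intro x hx b hb h
      simp only [hT] at h ⊢
      exact mem_of_mem_closure_gluing σ ν m hx hb h)
  have hcl : IsClosed (i '' (P.surface ∩ (σ.toFun '' (univ ×ˢ nbhdγ))ᶜ)) := by
    -- The collar has `ζ ≠ 0` and so misses the surface; the complement of the surface is thus the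
    -- union of two open images, one being the whole second piece.
    have h1 : (i '' (P.surface ∩ (σ.toFun '' (univ ×ˢ nbhdγ))ᶜ))ᶜ =
        i '' ((σ.toFun '' (univ ×ˢ nbhdγ))ᶜ ∩ P.surfaceᶜ) ∪ j '' {b | b.1 ∉ K} := by
      ext q
      constructor
      · intro hq
        have hq' := hg.cover ▸ mem_univ q
        rcases hq' with ⟨x, hx, rfl⟩ | hq'
        · exact Or.inl ⟨x, ⟨hx, fun h => hq ⟨x, ⟨h, hx⟩, rfl⟩⟩, rfl⟩
        · exact Or.inr hq'
      · rintro (⟨x, hx, rfl⟩ | ⟨b, hb, rfl⟩) ⟨x', hx', h⟩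
        · exact hx.2 (hg.injOn_left hx'.2 hx.1 h ▸ hx'.1)
        · obtain ⟨y, hy, rfl, -⟩ := (hT _ _).1 ((hg.eq_iff x' hx'.2 b hb).1 h)
          exact hy.1 ((σ.solid_mem_surface_iff (ne_of_mem_collar hy)).1 hx'.1)
    rw [← isOpen_compl_iff, h1]
    exact (hi.isOpen_image (hU.inter P.embedded.1.isOpen_compl) inter_subset_left).union
      (hj.isOpen_image hV subset_rfl)
  refine ⟨{ carrier := Q
            surface := i '' (P.surface ∩ (σ.toFun '' (univ ×ˢ nbhdγ))ᶜ)
            embedded := P.embedded.image hU hi hg.injOn_left hcl }, i, j, hi, hj, hg.injOn_left,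
    fun b hb b' hb' => hg.injOn_right.eq_iff hb hb', fun x hx b hb => ?_, hg.cover, ?_⟩
  · rw [hg.eq_iff x hx b hb, hT]
    exact (rim_gluing_iff σ ν m x b).symm
  · simp

end TwistRim

/-! ### Identification of the two surgeries. -/

namespace TwistRim

variable {P : SurfacePair.{u}} {α : Circle → P.carrier} {K : Set S3}

namespace KnotTube

variable (ν : KnotTube K) (m : ℤ)

/-- The covering of the product `S³ × S¹` by `S³ × ℝ`, which induces an isomorphism of the
mapping torus of the `m`-th power of the twist with the product. -/
def untwist (b : S3 × ℝ) : S3 × Circle := (ν.flow (-(m * b.2)) b.1, cover b.2)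

theorem isLocalDiffeomorphAt_untwist (b : S3 × ℝ) :
    IsLocalDiffeomorphAt ((𝓡 3).prod 𝓘(ℝ, ℝ)) ((𝓡 3).prod (𝓡 1)) ∞ (ν.untwist m) b := by
  refine (((ν.flowDiffeo (-m)).isLocalDiffeomorph b).comp _ _
    ((IsLocalDiffeomorphAt.id _).prodMap (isLocalDiffeomorph_cover _))).congr_of_eventuallyEq
    (Eventually.of_forall fun b => ?_)
  change (ν.flow (-(m * b.2)) b.1, cover b.2) = (ν.flow (-m * b.2) b.1, cover b.2)
  rw [neg_mul]

theorem untwist_mem_iff {b : S3 × ℝ} : (ν.untwist m b).1 ∈ K ↔ b.1 ∈ K := ν.flow_mem_iff _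

theorem untwist_surjective : Function.Surjective (ν.untwist m) := by
  rintro ⟨q, c⟩
  obtain ⟨s, rfl⟩ := cover_surjective c
  refine ⟨(ν.flow (m * s) q, s), Prod.ext ?_ rfl⟩
  change ν.flow _ (ν.flow _ _) = q
  rw [flow_flow, neg_add_cancel, flow_zero]

theorem untwist_tube {q : Circle × ℂ} (hq : ‖q.2‖ ≤ 2) (s : ℝ) :
    ν.untwist m (ν.toFun q, s) = ν.twisted m (cover s, q) :=
  Prod.ext (ν.flow_tube_of_norm_le m s q.1 hq) rfl

theorem twist_zpow_zpow (k : ℤ) (q : S3) : ((ν.twist ^ m) ^ k) q = ν.flow (m * k) q := by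
  rw [← zpow_mul, twist_zpow]
  push_cast
  rfl

/-- Equal circle coordinates mean `s' = s + k`, and the two flow times then differ by `mk`, where
the flow is `(τ^m)^k`. So the fibres of `untwist` are the classes of the mapping torus. -/
theorem untwist_eq_iff {b b' : S3 × ℝ} :
    ν.untwist m b = ν.untwist m b' ↔
      ∃ k : ℤ, b'.1 = ((ν.twist ^ m) ^ k) b.1 ∧ b'.2 = b.2 + k := by
  have key : ∀ k : ℤ, b'.2 = b.2 + k →
      (ν.flow (-(m * b.2)) b.1 = ν.flow (-(m * b'.2)) b'.1 ↔ b'.1 = ((ν.twist ^ m) ^ k) b.1) := by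
    intro k hk
    rw [eq_comm, flow_eq_iff, flow_flow, twist_zpow_zpow, hk]
    ring_nf
  rw [untwist, untwist, Prod.mk.injEq, cover_eq_iff]
  constructor
  · rintro ⟨h1, k, hk⟩
    exact ⟨k, (key k hk).1 h1, hk⟩
  · rintro ⟨k, h1, hk⟩
    exact ⟨(key k hk).2 h1, k, hk⟩

theorem twist_zpow_mem_iff (k : ℤ) {q : S3} : ((ν.twist ^ m) ^ k) q ∈ K ↔ q ∈ K := by
  rw [twist_zpow_zpow, flow_mem_iff]

theorem twist_zpow_core (k : ℤ) (c : Circle) :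
    ((ν.twist ^ m) ^ k) (ν.toFun (c, 0)) = ν.toFun (c, 0) := by
  rw [twist_zpow_zpow, flow_core]

theorem core_ne_point_iff {c : Circle} : ν.toFun (c, 0) ≠ ν.point ↔ (c, (0 : ℂ)) ≠ (1, 0) := by
  rw [point, Ne, ν.injective.eq_iff]

end KnotTube

variable {σ : CurveTrivialization P α} {ν : KnotTube K} {m : ℤ}

open Classical in
/-- The result of the rim torus surgery is also a result of the twist rim surgery. -/
theorem IsRimTorusSurgery.isTwistRimSurgery {Q : SurfacePair.{u}} (h : IsRimTorusSurgery σ ν m Q) :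
    IsTwistRimSurgery σ ν m Q := by
  obtain ⟨i, j, hil, hjl, hi, hj, hij, hcov, hS⟩ := h
  have hij' : ∀ a ∈ (σ.toFun '' (univ ×ˢ nbhdγ))ᶜ, ∀ b : S3 × Circle, b.1 ∉ K →
      (i a = j b ↔ ∃ y ∈ collar, σ.solid y = a ∧ ν.twisted m y = b) :=
    fun a ha b hb => (hij a ha b hb).trans (rim_gluing_iff σ ν m a b)
  have hUU : (σ.toFun '' (univ ×ˢ ball))ᶜ ⊆ (σ.toFun '' (univ ×ˢ nbhdγ))ᶜ :=
    compl_subset_compl.2 (image_mono (prod_mono subset_rfl nbhdγ_subset_ball))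
  have hsol : ∀ {y : Circle × (Circle × ℂ)}, y.2 ≠ (1, 0) → ‖y.2.2‖ < 2 →
      σ.solid y ∈ (σ.toFun '' (univ ×ˢ nbhdγ))ᶜ := fun h1 h2 => (σ.solid_mem_compl_iff h1).2 h2
  -- `E(K) × S¹` does not contain `K`, so the map on the mapping torus passes through the solid
  -- torus in `X - N(T)` near `K`, and through `untwist` elsewhere.
  let j' : S3 × ℝ → Q.carrier := fun b =>
    if h : ∃ q : Circle × ℂ, ‖q.2‖ < 2 ∧ ν.toFun q = b.1 then i (σ.solid (cover b.2, h.choose))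
    else j (ν.untwist m b)
  have hj1 : ∀ (q : Circle × ℂ) (s : ℝ), ‖q.2‖ < 2 →
      j' (ν.toFun q, s) = i (σ.solid (cover s, q)) := by
    intro q s hq
    have hex : ∃ q' : Circle × ℂ, ‖q'.2‖ < 2 ∧ ν.toFun q' = ν.toFun q := ⟨q, hq, rfl⟩
    have h2 : hex.choose = q := ν.injective hex.choose_spec.2
    simp only [j']
    rw [dif_pos hex, h2]
  -- On the overlap `0 < ‖ζ‖ < 2` the two formulas agree: `untwist` is `twisted` there, so the
  -- gluing relation `φ` identifies the two images.
  have hj2 : ∀ b : S3 × ℝ, b.1 ∉ K → j' b = j (ν.untwist m b) := by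
    intro b hb
    by_cases hex : ∃ q : Circle × ℂ, ‖q.2‖ < 2 ∧ ν.toFun q = b.1
    · obtain ⟨q, hq, hqb⟩ := hex
      obtain ⟨b1, s⟩ := b
      obtain rfl : ν.toFun q = b1 := hqb
      have hq0 : q.2 ≠ 0 := fun h => hb (ν.toFun_mem_iff.2 h)
      have hq1 : q ≠ (1, 0) := fun h => hq0 (congrArg Prod.snd h)
      rw [hj1 q s hq]
      refine (hij' _ (hsol hq1 hq) _ ((ν.untwist_mem_iff m).not.2 hb)).2
        ⟨(cover s, q), ⟨hq0, hq⟩, rfl, (ν.untwist_tube m hq.le s).symm⟩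
    · simp only [j']
      rw [dif_neg hex]
  have hz : ∀ c : Circle, ‖((c, (0 : ℂ)) : Circle × ℂ).2‖ < 2 := fun c => by simp
  -- A coincidence would put a point with `ζ = 0` into the collar.
  have hne : ∀ (c : Circle) (s : ℝ) (b : S3 × ℝ), (c, (0 : ℂ)) ≠ (1, 0) → b.1 ∉ K →
      j' (ν.toFun (c, 0), s) ≠ j' b := by
    intro c s b hc hb he
    rw [hj1 _ _ (hz c), hj2 b hb, hij' _ (hsol hc (hz c)) _ ((ν.untwist_mem_iff m).not.2 hb)] at he
    obtain ⟨y, hy, hyσ, -⟩ := he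
    have := σ.solid_injOn (ne_of_mem_collar hy) hc hyσ
    exact hy.1 (by rw [this])
  refine ⟨i, j', fun x => hil ⟨x.1, hUU x.2⟩, ?_, hi.mono hUU, ?_, ?_, ?_, ?_⟩
  · rintro ⟨⟨q, s⟩, hq⟩
    by_cases hqK : q ∈ K
    · obtain ⟨c, rfl⟩ := ν.exists_of_mem hqK
      have hc := ν.core_ne_point_iff.1 hq
      have h1 : IsLocalDiffeomorphAt (((𝓡 1).prod 𝓘(ℝ, ℂ)).prod 𝓘(ℝ, ℝ)) ((𝓡 3).prod 𝓘(ℝ, ℝ)) ∞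
          (Prod.map ν.toFun (fun t : ℝ => t)) ((c, 0), s) :=
        (ν.localDiffeo _).prodMap (IsLocalDiffeomorphAt.id s)
      have h2 : IsLocalDiffeomorphAt (((𝓡 1).prod 𝓘(ℝ, ℂ)).prod 𝓘(ℝ, ℝ))
          ((𝓡 1).prod ((𝓡 1).prod 𝓘(ℝ, ℂ))) ∞
          (fun x : (Circle × ℂ) × ℝ => (cover x.2, x.1)) ((c, 0), s) :=
        ((Diffeomorph.prodComm ((𝓡 1).prod 𝓘(ℝ, ℂ)) 𝓘(ℝ, ℝ) (Circle × ℂ) ℝ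
          ∞).isLocalDiffeomorph _).comp _ _
          ((isLocalDiffeomorph_cover _).prodMap (IsLocalDiffeomorphAt.id _))
      have h3 := (h2.comp _ _ (σ.isLocalDiffeomorphAt_solid hc)).comp _ _
        (hil ⟨_, hsol (y := (cover s, (c, 0))) hc (hz c)⟩)
      refine IsLocalDiffeomorphAt.of_comp (h := Prod.map ν.toFun (fun t : ℝ => t))
        (x := ((c, 0), s)) (h3.congr_of_eventuallyEq ?_) h1
      have hev : ∀ᶠ x : (Circle × ℂ) × ℝ in 𝓝 ((c, 0), s), ‖x.1.2‖ < 2 :=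
        (isOpen_lt (continuous_snd.comp continuous_fst).norm continuous_const).mem_nhds (hz c)
      filter_upwards [hev] with x hx
      exact hj1 x.1 x.2 hx
    · refine ((ν.isLocalDiffeomorphAt_untwist m (q, s)).comp _ _
        (hjl ⟨_, (ν.untwist_mem_iff m).not.2 hqK⟩)).congr_of_eventuallyEq ?_
      exact eventuallyEq_of_mem
        ((ν.isClosed_knot.isOpen_compl.preimage continuous_fst).mem_nhds hqK) hj2
  · rintro ⟨q, s⟩ hb ⟨q', s'⟩ hb'
    by_cases hqK : q ∈ K <;> by_cases hqK' : q' ∈ K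
    · obtain ⟨c, rfl⟩ := ν.exists_of_mem hqK
      obtain ⟨c', rfl⟩ := ν.exists_of_mem hqK'
      have hc := ν.core_ne_point_iff.1 hb
      have hc' := ν.core_ne_point_iff.1 hb'
      rw [hj1 _ _ (hz c), hj1 _ _ (hz c'), hi.eq_iff (hsol hc (hz c)) (hsol hc' (hz c')),
        σ.solid_injOn.eq_iff hc hc', Prod.mk.injEq, cover_eq_iff]
      simp only [ν.twist_zpow_core]
      constructor
      · rintro ⟨⟨k, hk⟩, h⟩
        exact ⟨k, by rw [h], hk⟩
      · rintro ⟨k, h, hk⟩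
        exact ⟨⟨k, hk⟩, (ν.injective h).symm⟩
    · obtain ⟨c, rfl⟩ := ν.exists_of_mem hqK
      refine iff_of_false (hne c s _ (ν.core_ne_point_iff.1 hb) hqK') ?_
      rintro ⟨k, h, -⟩
      have h' : q' = ((ν.twist ^ m) ^ k) (ν.toFun (c, 0)) := h
      rw [h', ν.twist_zpow_mem_iff] at hqK'
      exact hqK' hqK
    · obtain ⟨c, rfl⟩ := ν.exists_of_mem hqK'
      refine iff_of_false (hne c s' _ (ν.core_ne_point_iff.1 hb') hqK).symm ?_
      rintro ⟨k, h, -⟩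
      exact hqK ((ν.twist_zpow_mem_iff m k).1 (h ▸ hqK'))
    · rw [hj2 _ hqK, hj2 _ hqK', hj _ ((ν.untwist_mem_iff m).not.2 hqK) _
        ((ν.untwist_mem_iff m).not.2 hqK'), ν.untwist_eq_iff]
  · rintro a ha ⟨q, s⟩ hb
    have hwb : ∀ {p : ℝ × ℂ}, p ∉ ball → winding p ≠ 0 ∧ ‖(toSolidTorus p).2‖ < 2 := by
      intro p hp
      have h1 : p ∉ nbhdγ := fun h => hp (nbhdγ_subset_ball h)
      exact ⟨winding_ne_zero_of_notMem h1, (notMem_nbhdγ_iff (winding_ne_zero_of_notMem h1)).1 h1⟩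
    constructor
    · intro he
      -- Whether or not `q` lies on `K`, a coincidence comes from a point `x` of the solid torus
      -- over `cover s`; the ball coordinate of `a` is then `fromSolidTorus x`.
      obtain ⟨x, hx1, hxa, hxq⟩ : ∃ x : Circle × ℂ, x ≠ (1, 0) ∧ a = σ.solid (cover s, x) ∧
          q = ν.toFun x := by
        by_cases hqK : q ∈ K
        · obtain ⟨c, rfl⟩ := ν.exists_of_mem hqK
          have hc := ν.core_ne_point_iff.1 hb
          rw [hj1 _ _ (hz c), hi.eq_iff (hUU ha) (hsol hc (hz c))] at he
          exact ⟨_, hc, he, rfl⟩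
        · rw [hj2 _ hqK, hij' a (hUU ha) _ ((ν.untwist_mem_iff m).not.2 hqK)] at he
          obtain ⟨⟨θ, x⟩, hy, rfl, hyν⟩ := he
          obtain rfl : θ = cover s := congrArg Prod.snd hyν
          rw [← ν.untwist_tube m hy.2.le] at hyν
          refine ⟨x, ne_of_mem_collar hy, rfl, ?_⟩
          obtain ⟨k, h1, h2⟩ := (ν.untwist_eq_iff m).1 hyν
          -- Both points have the same real coordinate `s`, so no deck translation intervenes.
          have hk : k = 0 := by
            have h3 : s = s + k := h2
            exact_mod_cast (left_eq_add.1 h3 : (k : ℝ) = 0)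
          simpa [hk] using h1
      refine ⟨fromSolidTorus x, fun hp => ?_, hxa, ?_⟩
      · rw [hxa] at ha
        exact ha (σ.mem_image_iff.2 hp)
      · rw [toSolidTorus_fromSolidTorus hx1]
        exact hxq
    · rintro ⟨p, hp, rfl, hpq⟩
      obtain ⟨hw, hlt⟩ := hwb hp
      obtain rfl : q = ν.toFun (toSolidTorus p) := hpq
      rw [hj1 _ _ hlt, ← σ.exists_solid_eq hw]
      rfl
  · refine eq_univ_of_forall fun x => ?_
    have hx := hcov ▸ mem_univ x
    rcases hx with ⟨a, ha, rfl⟩ | ⟨b, hb, rfl⟩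
    -- Only the part of `X - N(T)` inside the tube of `α` changes sides: it is now covered by the
    -- mapping torus.
    · by_cases haU : a ∈ σ.toFun '' (univ ×ˢ ball)
      · obtain ⟨⟨θ, p⟩, -, rfl⟩ := haU
        have hp : p ∉ nbhdγ := fun h => ha (σ.mem_image_iff.2 h)
        have hw := winding_ne_zero_of_notMem hp
        obtain ⟨s, rfl⟩ := cover_surjective θ
        refine Or.inr ⟨(ν.toFun (toSolidTorus p), s), fun h => ?_, ?_⟩
        · exact toSolidTorus_ne hw (ν.injective h)
        · rw [hj1 _ _ ((notMem_nbhdγ_iff hw).1 hp), σ.exists_solid_eq hw]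
      · exact Or.inl ⟨a, haU, rfl⟩
    · obtain ⟨b', rfl⟩ := ν.untwist_surjective m b
      have hb' : b'.1 ∉ K := (ν.untwist_mem_iff m).not.1 hb
      refine Or.inr ⟨b', fun h => hb' ?_, hj2 b' hb'⟩
      rw [show b'.1 = ν.point from h]
      exact ν.core_mem 1
  -- The surface of the second description is all of `Σ`; its part inside the tube of `α` has `ζ =
  -- 0` and is the image of `K` minus the point.
  · rw [hS, empty_inter, image_empty, union_empty]
    ext x
    constructor
    · rintro ⟨a, ⟨haS, ha⟩, rfl⟩
      by_cases haU : a ∈ σ.toFun '' (univ ×ˢ ball)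
      · obtain ⟨⟨θ, p⟩, -, rfl⟩ := haU
        have hp : p ∉ nbhdγ := fun h => ha (σ.mem_image_iff.2 h)
        have hw := winding_ne_zero_of_notMem hp
        obtain ⟨s, rfl⟩ := cover_surjective θ
        rw [σ.exists_solid_eq hw] at haS ⊢
        refine Or.inr ⟨(ν.toFun (toSolidTorus p), s), ⟨?_, fun h => ?_⟩, ?_⟩
        · exact ν.toFun_mem_iff.2 ((σ.solid_mem_surface_iff (toSolidTorus_ne hw)).1 haS)
        · exact toSolidTorus_ne hw (ν.injective h)
        · exact hj1 _ _ ((notMem_nbhdγ_iff hw).1 hp)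
      · exact Or.inl ⟨a, ⟨haS, haU⟩, rfl⟩
    · rintro (⟨a, ⟨haS, ha⟩, rfl⟩ | ⟨⟨q, s⟩, ⟨hqK, hb⟩, rfl⟩)
      · exact ⟨a, ⟨haS, hUU ha⟩, rfl⟩
      · obtain ⟨c, rfl⟩ := ν.exists_of_mem hqK
        have hc := ν.core_ne_point_iff.1 hb
        exact ⟨_, ⟨(σ.solid_mem_surface_iff (y := (cover s, (c, 0))) hc).2 rfl, hsol hc (hz c)⟩,
          (hj1 _ _ (hz c)).symm⟩

theorem IsTwistRimSurgery.pairwiseDiffeomorphic {Q Q' : SurfacePair.{u}}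
    (h : IsTwistRimSurgery σ ν m Q) (h' : IsTwistRimSurgery σ ν m Q') :
    PairwiseDiffeomorphic Q Q' :=
  IsGluing.pairwiseDiffeomorphic (σ.isOpen_compl_image isCompact_ball)
    (isOpen_ne_fun continuous_fst continuous_const) h h'

end TwistRim
end

theorem lemma2 (P : TwistRim.SurfacePair.{u}) (α : Circle → P.carrier)
    (σ : TwistRim.CurveTrivialization P α)
    (K : Set TwistRim.S3) (ν : TwistRim.KnotTube K) (hν : ν.IsZeroFramed) (m : ℤ) :
    (∃ Q : TwistRim.SurfacePair.{u}, TwistRim.IsTwistRimSurgery σ ν m Q) ∧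
    (∃ Q : TwistRim.SurfacePair.{u}, TwistRim.IsRimTorusSurgery σ ν m Q) ∧
    ∀ Q Q' : TwistRim.SurfacePair.{u},
      TwistRim.IsTwistRimSurgery σ ν m Q → TwistRim.IsRimTorusSurgery σ ν m Q' →
        TwistRim.PairwiseDiffeomorphic Q Q' := by
  obtain ⟨Q₀, hQ₀⟩ := TwistRim.exists_isRimTorusSurgery σ ν m
  exact ⟨⟨Q₀, hQ₀.isTwistRimSurgery⟩, ⟨Q₀, hQ₀⟩, fun Q Q' h h' =>
    h.pairwiseDiffeomorphic h'.isTwistRimSurgery⟩
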